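/- **Theorem 2.2 (hydrodynamic limit).** Let $b,c\in C[0,1]$ and $\lambda,a_1,a_2,a_3,a_4\in C([0,1]\times[0,1])$ be non-negative. For each $N\ge 1$ let $\{X_t^N\}_{t\ge 0}$ be the continuous-time Markov process on $[0,\infty)^N$ with generator $$\mathcal L_N g(x)=\sum_{i=1}^N b\left(\tfrac iN\right)\left(g(x^{i,+})-g(x)\right)+\frac1N\sum_{i=1}^N\sum_{j\ne i}\lambda\left(\tfrac iN,\tfrac jN\right)\left(g(x^{(i,j)})-g(x)\right),$$ where $x^{i,+}$ is obtained from $x$ by replacing $x(i)$ by $c(\frac iN)x(i)$, and $x^{(i,j)}$ is obtained from $x$ by replacing $x(i)$ by $a_1(\frac iN,\frac jN)x(i)+a_2(\frac iN,\frac jN)x(j)$ and $x(j)$ by $a_3(\frac iN,\frac jN)x(i)+a_4(\frac iN,\frac jN)x(j)$. Assume (Assumption (A)) that for every $N$ the variables $X_0^N(1),\dots,X_0^N(N)$ are independent with $P(X_0^N(i)=1)=\phi(\frac iN)=1-P(X_0^N(i)=0)$, where $\phi\in C[0,1]$. Put $\mu_t^N(f)=\frac1N\sum_{i=1}^N X_t^N(i)f(\frac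 iN)$ for $f\in C[0,1]$. Let $P_1:C[0,1]\to C[0,1]$ be the bounded linear operator $$\begin{aligned}P_1f(u)={}&b(u)(c(u)-1)f(u)+f(u)\int_0^1\lambda(u,v)(a_1(u,v)-1)\,dv+\int_0^1\lambda(u,v)a_3(u,v)f(v)\,dv\\&+f(u)\int_0^1\lambda(v,u)(a_4(v,u)-1)\,dv+\int_0^1\lambda(v,u)f(v)a_2(v,u)\,dv,\end{aligned}$$ and let $P_1^*$ be its adjoint on the dual space $(C[0,1])'$, $(P_1^*\nu)(f)=\nu(P_1f)$. Then: 1. The $(C[0,1])'$-valued equation $\frac{d}{dt}\mu_t=P_1^*\mu_t$ for $t\ge0$, $\mu_0(du)=\phi(u)\,du$ (derivative in the dual norm) has a unique solution $\{\mu_t\}_{t\ge0}$. 2. The $C[0,1]$-valued equation (derivative in the supremum norm) $$\begin{aligned}\frac{d}{dt}\rho(t,u)={}&b(u)(c(u)-1)\rho(t,u)+\rho(t,u)\int_0^1\lambda(v,u)(a_4(v,u)-1)\,dv+\rho(t,u)\int_0^1\lambda(u,v)(a_1(u,v)-1)\,dv\\&+\int_0^1\lambda(u,v)a_2(u,v)\rho(t,v)\,dv+\int_0^1\lambda(v,u)a_3(v,u)\rho(t,v)\,dv,\qquad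 \rho(0,\cdot)=\phi,\end{aligned}$$ for $t\ge 0$ has a unique solution $\{\rho(t,\cdot)\}_{t\ge0}$. 3. For every $t\ge0$ and $f\in C[0,1]$, the variables $\mu_t^N(f)$ are square integrable and $$\lim_{N\to\infty}\mu_t^N(f)=\mu_t(f)=\int_0^1\rho(t,u)f(u)\,du\quad\text{in }L^2.$$ -/

import Mathlib

open MeasureTheory ProbabilityTheory Filter Topology
open scoped NNReal ENNReal unitInterval BoundedContinuousFunction

noncomputable section

/-- The non-negative continuous coefficient functions of the model:
`b, c` on `[0,1]` and `lam, a₁, a₂, a₃, a₄` on `[0,1] × [0,1]`. -/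
structure UrnCoefficients where
  b : C(I, ℝ≥0)
  c : C(I, ℝ≥0)
  lam : C(I × I, ℝ≥0)
  a₁ : C(I × I, ℝ≥0)
  a₂ : C(I × I, ℝ≥0)
  a₃ : C(I × I, ℝ≥0)
  a₄ : C(I × I, ℝ≥0)

/-- The configuration space `[0,∞)^N` with its product topology and Borel σ-algebra. -/
abbrev Config (N : ℕ) : Type := Fin N → ℝ≥0

/-- The macroscopic position of an urn. The urns `1, …, N` are indexed by `Fin N = {0, …, N - 1}`,
so that urn number `i + 1` has the position `(i + 1) / N`. -/
def site {N : ℕ} (i : Fin N) : I :=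
  ⟨((i : ℕ) + 1 : ℝ) / (N : ℝ), by positivity, by
    have h : ((i : ℕ) + 1 : ℝ) ≤ (N : ℝ) := by exact_mod_cast i.isLt
    exact div_le_one_of_le₀ h (Nat.cast_nonneg N)⟩

/-- The exponential `∑ A ^ n / n!` of a bounded operator on a normed space. -/
def expOp {E : Type*} [NormedAddCommGroup E] [NormedSpace ℝ E] (A : E →L[ℝ] E) : E →L[ℝ] E :=
  NormedSpace.exp A

namespace UrnCoefficients

variable (κ : UrnCoefficients) {N : ℕ}

/-- The transformed configuration `x^{i,+}`. -/
def selfJump (i : Fin N) : C(Config N, Config N) where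
  toFun x k := if k = i then κ.c (site i) * x i else x k
  continuous_toFun := by
    refine continuous_pi fun k => ?_
    split_ifs <;> fun_prop

/-- The transformed configuration `x^{(i,j)}` (used for `i ≠ j`). -/
def pairJump (i j : Fin N) : C(Config N, Config N) where
  toFun x k :=
    if k = i then κ.a₁ (site i, site j) * x i + κ.a₂ (site i, site j) * x j
    else if k = j then κ.a₃ (site i, site j) * x i + κ.a₄ (site i, site j) * x j
    else x k
  continuous_toFun := by
    refine continuous_pi fun k => ?_
    split_ifs <;> fun_prop

/-- The generator of the `N`-urn linear system, as a bounded operator on the Banach space of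
bounded continuous functions on `[0,∞)^N`; see `generator_apply` for its values. -/
def generator (N : ℕ) : (Config N →ᵇ ℝ) →L[ℝ] (Config N →ᵇ ℝ) :=
  (∑ i : Fin N, (κ.b (site i) : ℝ) •
      (BoundedContinuousFunction.compContinuousCLM ℝ ℝ (κ.selfJump i) -
        ContinuousLinearMap.id ℝ (Config N →ᵇ ℝ))) +
    (1 / (N : ℝ)) • ∑ i : Fin N, ∑ j ∈ Finset.univ.erase i, (κ.lam (site i, site j) : ℝ) •
      (BoundedContinuousFunction.compContinuousCLM ℝ ℝ (κ.pairJump i j) -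
        ContinuousLinearMap.id ℝ (Config N →ᵇ ℝ))

theorem generator_apply (N : ℕ) (f : Config N →ᵇ ℝ) (x : Config N) :
    κ.generator N f x =
      (∑ i : Fin N, (κ.b (site i) : ℝ) * (f (κ.selfJump i x) - f x)) +
        (1 / (N : ℝ)) * ∑ i : Fin N, ∑ j ∈ Finset.univ.erase i,
          (κ.lam (site i, site j) : ℝ) * (f (κ.pairJump i j x) - f x) := by
  simp [generator, BoundedContinuousFunction.coe_sum]

/-- The Markov semigroup `S(t) = exp (t L)` with the (bounded) generator `L`. -/
def semigroup (N : ℕ) (t : ℝ≥0) : (Config N →ᵇ ℝ) →L[ℝ] (Config N →ᵇ ℝ) :=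
  expOp ((t : ℝ) • κ.generator N)

/-- `X` is, on the probability space `(Ω, P)`, an `N`-urn linear system: a continuous-time Markov
process on `[0,∞)^N` whose semigroup is generated by `κ.generator N`. The conditional expectation
is taken given the past `σ(X r, r ≤ s)`. -/
structure IsUrnSystem {Ω : Type*} [MeasurableSpace Ω] (N : ℕ) (P : Measure Ω)
    (X : ℝ≥0 → Ω → Config N) : Prop where
  measurable : ∀ t, Measurable (X t)
  markov : ∀ (s t : ℝ≥0) (f : Config N →ᵇ ℝ),
    P[fun ω => f (X (s + t) ω) | ⨆ r ∈ Set.Iic s, MeasurableSpace.comap (X r) inferInstance]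
      =ᵐ[P] fun ω => κ.semigroup N t f (X s ω)

end UrnCoefficients

/-- The initial assumption: the coordinates of the initial configuration are independent and the
one at position `u` is Bernoulli with parameter `φ u`. -/
structure BernoulliInitial {Ω : Type*} [MeasurableSpace Ω] (φ : C(I, ℝ)) {N : ℕ} (P : Measure Ω)
    (X₀ : Ω → Config N) : Prop where
  indep : iIndepFun (fun i ω => X₀ ω i) P
  prob_one : ∀ i, P.real {ω | X₀ ω i = 1} = φ (site i)
  prob_zero : ∀ i, P.real {ω | X₀ ω i = 0} = 1 - φ (site i)

/-- The empirical measure of a configuration, evaluated at a test function. -/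
def empirical {N : ℕ} (x : Config N) (f : C(I, ℝ)) : ℝ :=
  (1 / (N : ℝ)) * ∑ i : Fin N, (x i : ℝ) * f (site i)

/-- The integral operator `f ↦ ∫₀¹ k(·, v) f(v) dv` on `C[0,1]`. -/
def integralOp (k : C(I × I, ℝ)) : C(I, ℝ) →L[ℝ] C(I, ℝ) :=
  LinearMap.mkContinuous
    { toFun := fun f =>
        { toFun := fun u => ∫ v : I, k (u, v) * f v
          continuous_toFun := by
            have h := continuous_parametric_integral_of_continuous (μ := (volume : Measure I))
              (f := fun u v : I => k (u, v) * f v) (by fun_prop) (isCompact_univ (X := I))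
            simpa using h }
      map_add' := fun f g => by
        ext u
        simp only [ContinuousMap.coe_mk, ContinuousMap.add_apply, mul_add]
        refine integral_add ?_ ?_ <;>
          exact (by fun_prop : Continuous _).integrable_of_hasCompactSupport
            (HasCompactSupport.of_compactSpace _)
      map_smul' := fun r f => by
        ext u
        simp only [ContinuousMap.coe_mk, ContinuousMap.smul_apply, smul_eq_mul, RingHom.id_apply,
          ← integral_const_mul]
        refine integral_congr_ae (Eventually.of_forall fun v => ?_)
        simp only []
        ring }
    ‖k‖ (fun f => by
      rw [ContinuousMap.norm_le _ (by positivity)]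
      intro u
      have h := norm_integral_le_of_norm_le_const (μ := (volume : Measure I))
        (f := fun v : I => k (u, v) * f v) (C := ‖k‖ * ‖f‖)
        (Eventually.of_forall fun v => by
          rw [norm_mul]
          exact mul_le_mul (k.norm_coe_le_norm _) (f.norm_coe_le_norm _) (norm_nonneg _)
            (norm_nonneg _))
      simpa using h)

theorem integralOp_apply (k : C(I × I, ℝ)) (f : C(I, ℝ)) (u : I) :
    integralOp k f u = ∫ v : I, k (u, v) * f v := rfl

namespace UrnCoefficients

variable (κ : UrnCoefficients)

/-- The kernel `(u, v) ↦ λ(u,v) (a₁(u,v) - 1) + λ(v,u) (a₄(v,u) - 1)`. -/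
def lossKernel : C(I × I, ℝ) where
  toFun p := (κ.lam p : ℝ) * ((κ.a₁ p : ℝ) - 1) +
    (κ.lam p.swap : ℝ) * ((κ.a₄ p.swap : ℝ) - 1)

/-- The factor in the multiplication part common to both limiting operators:
`b(u) (c(u) - 1) + ∫₀¹ λ(u,v) (a₁(u,v) - 1) dv + ∫₀¹ λ(v,u) (a₄(v,u) - 1) dv`. -/
def rate : C(I, ℝ) :=
  ⟨fun u => (κ.b u : ℝ) * ((κ.c u : ℝ) - 1), by fun_prop⟩ + integralOp κ.lossKernel 1

/-- The operator `P₁` on `C[0,1]`; see `opP₁_apply` for its values. -/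
def opP₁ : C(I, ℝ) →L[ℝ] C(I, ℝ) :=
  ContinuousLinearMap.mul ℝ C(I, ℝ) κ.rate +
    integralOp ⟨fun p => (κ.lam p : ℝ) * (κ.a₃ p : ℝ) +
      (κ.lam p.swap : ℝ) * (κ.a₂ p.swap : ℝ), by fun_prop⟩

/-- The operator on `C[0,1]` on the right-hand side of the equation for the density; see
`densityOp_apply` for its values. -/
def densityOp : C(I, ℝ) →L[ℝ] C(I, ℝ) :=
  ContinuousLinearMap.mul ℝ C(I, ℝ) κ.rate +
    integralOp ⟨fun p => (κ.lam p : ℝ) * (κ.a₂ p : ℝ) +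
      (κ.lam p.swap : ℝ) * (κ.a₃ p.swap : ℝ), by fun_prop⟩

theorem rate_apply (u : I) :
    κ.rate u = (κ.b u : ℝ) * ((κ.c u : ℝ) - 1)
      + (∫ v : I, (κ.lam (u, v) : ℝ) * ((κ.a₁ (u, v) : ℝ) - 1))
      + (∫ v : I, (κ.lam (v, u) : ℝ) * ((κ.a₄ (v, u) : ℝ) - 1)) := by
  rw [add_assoc, ← integral_add]
  · simp [rate, integralOp_apply, lossKernel]
  all_goals
    exact (by fun_prop : Continuous _).integrable_of_hasCompactSupport
      (HasCompactSupport.of_compactSpace _)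

theorem opP₁_apply (f : C(I, ℝ)) (u : I) :
    κ.opP₁ f u = (κ.b u : ℝ) * ((κ.c u : ℝ) - 1) * f u
      + f u * (∫ v : I, (κ.lam (u, v) : ℝ) * ((κ.a₁ (u, v) : ℝ) - 1))
      + (∫ v : I, (κ.lam (u, v) : ℝ) * (κ.a₃ (u, v) : ℝ) * f v)
      + f u * (∫ v : I, (κ.lam (v, u) : ℝ) * ((κ.a₄ (v, u) : ℝ) - 1))
      + (∫ v : I, (κ.lam (v, u) : ℝ) * f v * (κ.a₂ (v, u) : ℝ)) := by
  have h : κ.opP₁ f u = κ.rate u * f u +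
      ((∫ v : I, (κ.lam (u, v) : ℝ) * (κ.a₃ (u, v) : ℝ) * f v)
      + (∫ v : I, (κ.lam (v, u) : ℝ) * f v * (κ.a₂ (v, u) : ℝ))) := by
    rw [← integral_add]
    · simp only [opP₁, add_apply, ContinuousMap.add_apply,
        ContinuousLinearMap.mul_apply', ContinuousMap.mul_apply, integralOp_apply,
        ContinuousMap.coe_mk, Prod.swap_prod_mk]
      congr 1
      refine integral_congr_ae (Eventually.of_forall fun v => ?_)
      simp only []
      ring
    all_goals
      exact (by fun_prop : Continuous _).integrable_of_hasCompactSupport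
        (HasCompactSupport.of_compactSpace _)
  rw [h, rate_apply]
  ring

theorem densityOp_apply (f : C(I, ℝ)) (u : I) :
    κ.densityOp f u = (κ.b u : ℝ) * ((κ.c u : ℝ) - 1) * f u
      + f u * (∫ v : I, (κ.lam (v, u) : ℝ) * ((κ.a₄ (v, u) : ℝ) - 1))
      + f u * (∫ v : I, (κ.lam (u, v) : ℝ) * ((κ.a₁ (u, v) : ℝ) - 1))
      + (∫ v : I, (κ.lam (u, v) : ℝ) * (κ.a₂ (u, v) : ℝ) * f v)
      + (∫ v : I, (κ.lam (v, u) : ℝ) * (κ.a₃ (v, u) : ℝ) * f v) := by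
  have h : κ.densityOp f u = κ.rate u * f u +
      ((∫ v : I, (κ.lam (u, v) : ℝ) * (κ.a₂ (u, v) : ℝ) * f v)
      + (∫ v : I, (κ.lam (v, u) : ℝ) * (κ.a₃ (v, u) : ℝ) * f v)) := by
    rw [← integral_add]
    · simp only [densityOp, add_apply, ContinuousMap.add_apply,
        ContinuousLinearMap.mul_apply', ContinuousMap.mul_apply, integralOp_apply,
        ContinuousMap.coe_mk, Prod.swap_prod_mk]
      congr 1
      refine integral_congr_ae (Eventually.of_forall fun v => ?_)
      simp only []
      ring
    all_goals
      exact (by fun_prop : Continuous _).integrable_of_hasCompactSupport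
        (HasCompactSupport.of_compactSpace _)
  rw [h, rate_apply]
  ring

/-- `μ` solves, on `[0,∞)` and in the dual norm, the equation `dμ_t/dt = P₁^* μ_t` in `(C[0,1])'`
with the initial value `μ_0(du) = φ(u) du`. Here `P₁^* ν = ν ∘ P₁`. The derivative is one-sided
at `t = 0` and two-sided at `t > 0`. -/
structure IsHydrodynamicSolution (φ : C(I, ℝ)) (μ : ℝ → (C(I, ℝ) →L[ℝ] ℝ)) : Prop where
  deriv : ∀ t, 0 ≤ t → HasDerivWithinAt μ ((μ t).comp κ.opP₁) (Set.Ici 0) t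
  init : ∀ f : C(I, ℝ), μ 0 f = ∫ u : I, φ u * f u

/-- `ρ` solves, on `[0,∞)` and in the supremum norm, the `C[0,1]`-valued equation for the density
with the initial value `φ`. -/
structure IsDensitySolution (φ : C(I, ℝ)) (ρ : ℝ → C(I, ℝ)) : Prop where
  deriv : ∀ t, 0 ≤ t → HasDerivWithinAt ρ (κ.densityOp (ρ t)) (Set.Ici 0) t
  init : ρ 0 = φ

end UrnCoefficients

end

/-! The generator sends the linear functional `empirical · g` to a linear functional of the
configuration that is close to `empirical · (κ.opP₁ g)`. The equation for the first moment is
therefore closed in the limit, and the second moment of the error can be estimated directly, without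
martingales or tightness.

Fix `t` and `f` and move the test function backwards: `g s = exp((t - s) P₁) f`, so that `g t = f`
and `g' = -P₁ g`. Put `a = ∫ φ · g 0`, which is `μ_t(f)`. In the derivative of `E (μ_s^N(g s) - a)²`
the motion of `g` cancels the limiting drift. Two errors remain: the difference between sums over
sites and integrals, including the missing diagonal of order `1/N`, and the carré du champ, of order
`1/N` because a jump moves the empirical measure by `O(1/N)` and the total jump rate is `O(N)`. Both
are bounded by a small constant times `1 + meanSq`, whose expectation is bounded uniformly in `N` on
`[0, t]`. At time `0` independence gives a variance of order `1/N`, and the bias is a Riemann sum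
error. This is `IsBound.integral_sq_empirical_sub_le`, fed by `IsBound.jumpGen_sq_empirical_le` and
`BernoulliInitial.integral_sq_empirical_sub_le`.

The semigroup only acts on bounded functions, while the functions above are unbounded. The forward
equation is extended to functions dominated by a Lyapunov function `V` through the truncations `h /
(1 + ε V)` (`hasDerivWithinAt_integral`, `hasDerivWithinAt_integral_sq`).

Both limiting equations are linear with bounded operators: exponentials solve them and the Lipschitz
property gives uniqueness. By Fubini the density operator is dual to `P₁`, so a density solution
yields the hydrodynamic solution. -/

noncomputable section

/-! ### Jump generators and the forward equation for unbounded test functions. -/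

section JumpGenerator

variable {E J : Type*} [TopologicalSpace E] [Fintype J]

/-- The generator `h ↦ ∑ₑ wₑ (h ∘ Tₑ - h)` of the jump process which applies the map `Tₑ` at the
rate `wₑ`, on arbitrary real functions. -/
def jumpGen (w : J → ℝ) (T : J → C(E, E)) (h : E → ℝ) (x : E) : ℝ :=
  ∑ e, w e * (h (T e x) - h x)

variable {w : J → ℝ} {T : J → C(E, E)}

theorem continuous_jumpGen {h : E → ℝ} (hh : Continuous h) : Continuous (jumpGen w T h) := by
  unfold jumpGen
  fun_prop

/-- Splits the generator of a square into the chain-rule term and the carré du champ; only the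
latter carries the fluctuations. -/
theorem jumpGen_sq (h : E → ℝ) (x : E) :
    jumpGen w T (fun y => h y ^ 2) x =
      2 * h x * jumpGen w T h x + ∑ e, w e * (h (T e x) - h x) ^ 2 := by
  simp only [jumpGen, Finset.mul_sum, ← Finset.sum_add_distrib]
  refine Finset.sum_congr rfl fun e _ => ?_
  ring

theorem jumpGen_sum {ι : Type*} (s : Finset ι) (c : ι → ℝ) (h : ι → E → ℝ) (x : E) :
    jumpGen w T (fun y => ∑ k ∈ s, c k * h k y) x = ∑ k ∈ s, c k * jumpGen w T (h k) x := by
  simp only [jumpGen, Finset.mul_sum, ← Finset.sum_sub_distrib]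
  rw [Finset.sum_comm]
  refine Finset.sum_congr rfl fun k _ => Finset.sum_congr rfl fun e _ => ?_
  ring

/-- `V` is a Lyapunov function with the growth rate `C`, multiplied at most by `M` at each jump. -/
structure IsLyapunov (w : J → ℝ) (T : J → C(E, E)) (V : E → ℝ) (C M : ℝ) : Prop where
  continuous : Continuous V
  nonneg : ∀ x, 0 ≤ V x
  rate_nonneg : ∀ e, 0 ≤ w e
  growth_nonneg : 0 ≤ C
  factor_nonneg : 0 ≤ M
  jumpGen_le : ∀ x, jumpGen w T V x ≤ C * V x
  comp_le : ∀ e x, V (T e x) ≤ M * V x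

namespace IsLyapunov

variable {V : E → ℝ} {C M : ℝ}

theorem abs_jumpGen_le (hV : IsLyapunov w T V C M) {h : E → ℝ} {A : ℝ} (hA : 0 ≤ A)
    (hh : ∀ x, |h x| ≤ A * V x) (x : E) :
    |jumpGen w T h x| ≤ (∑ e, w e * (M + 1) * A) * V x := by
  unfold jumpGen
  refine (Finset.abs_sum_le_sum_abs _ _).trans ?_
  rw [Finset.sum_mul]
  refine Finset.sum_le_sum fun e _ => ?_
  rw [abs_mul, abs_of_nonneg (hV.rate_nonneg e)]
  have h1 : |h (T e x) - h x| ≤ (M + 1) * A * V x := by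
    have h2 := abs_sub (h (T e x)) (h x)
    have h3 := (hh (T e x)).trans (mul_le_mul_of_nonneg_left (hV.comp_le e x) hA)
    have h4 := hh x
    nlinarith
  calc w e * |h (T e x) - h x| ≤ w e * ((M + 1) * A * V x) :=
        mul_le_mul_of_nonneg_left h1 (hV.rate_nonneg e)
    _ = w e * (M + 1) * A * V x := by ring

/-- The bounded function `h / (1 + ε V)`, for a function `h` which is dominated by `V`. -/
def truncation (hV : IsLyapunov w T V C M) {h : E → ℝ} (hc : Continuous h) {A : ℝ}
    (hA : 0 ≤ A) (hh : ∀ x, |h x| ≤ A * V x) {ε : ℝ} (hε : 0 < ε) : E →ᵇ ℝ :=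
  BoundedContinuousFunction.ofNormedAddCommGroup (fun x => h x / (1 + ε * V x))
    (hc.div (by have := hV.continuous; fun_prop) fun x => by
      have := hV.nonneg x
      positivity) (A / ε) (fun x => by
      have h0 := hV.nonneg x
      have h1 : 0 < 1 + ε * V x := by positivity
      rw [Real.norm_eq_abs, abs_div, abs_of_pos h1, div_le_div_iff₀ h1 hε]
      nlinarith [hh x, mul_le_mul_of_nonneg_right (hh x) hε.le])

theorem truncation_apply (hV : IsLyapunov w T V C M) {h : E → ℝ} (hc : Continuous h) {A : ℝ}
    (hA : 0 ≤ A) (hh : ∀ x, |h x| ≤ A * V x) {ε : ℝ} (hε : 0 < ε) (x : E) :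
    hV.truncation hc hA hh hε x = h x / (1 + ε * V x) := rfl

theorem abs_truncation_le (hV : IsLyapunov w T V C M) {h : E → ℝ} (hc : Continuous h) {A : ℝ}
    (hA : 0 ≤ A) (hh : ∀ x, |h x| ≤ A * V x) {ε : ℝ} (hε : 0 < ε) (x : E) :
    |hV.truncation hc hA hh hε x| ≤ A * V x := by
  have h0 := hV.nonneg x
  have h1 : 0 ≤ ε * V x := by positivity
  rw [truncation_apply, abs_div, abs_of_pos (by linarith : 0 < 1 + ε * V x)]
  exact (div_le_self (abs_nonneg _) (by linarith)).trans (hh x)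

theorem tendsto_truncation (hV : IsLyapunov w T V C M) {h : E → ℝ} (hc : Continuous h) {A : ℝ}
    (hA : 0 ≤ A) (hh : ∀ x, |h x| ≤ A * V x) (x : E) :
    Tendsto (fun n : ℕ => hV.truncation hc hA hh (Nat.one_div_pos_of_nat (α := ℝ) (n := n)) x) atTop
      (𝓝 (h x)) := by
  simp only [truncation_apply]
  have h1 : Tendsto (fun n : ℕ => 1 + 1 / ((n : ℝ) + 1) * V x) atTop (𝓝 (1 + 0 * V x)) :=
    (tendsto_one_div_add_atTop_nhds_zero_nat.mul_const _).const_add _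
  have h2 := Tendsto.div (tendsto_const_nhds (x := h x)) h1 (by simp)
  rw [zero_mul, add_zero, div_one] at h2
  exact h2

/-- Concave truncations of a Lyapunov function are Lyapunov functions with the same rate. -/
theorem jumpGen_truncation_le (hV : IsLyapunov w T V C M) {ε : ℝ} (hε : 0 < ε) (x : E) :
    jumpGen w T (fun y => V y / (1 + ε * V y)) x ≤ C * (V x / (1 + ε * V x)) := by
  have hp : ∀ y, 0 < 1 + ε * V y := fun y => by
    have := hV.nonneg y
    positivity
  -- The map `v ↦ v / (1 + ε v)` is concave with derivative `1 / (1 + ε v) ^ 2`, so each increment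
  -- lies below its tangent.
  have key : jumpGen w T (fun y => V y / (1 + ε * V y)) x ≤
      jumpGen w T V x / (1 + ε * V x) ^ 2 := by
    unfold jumpGen
    rw [Finset.sum_div]
    refine Finset.sum_le_sum fun e _ => ?_
    rw [mul_div_assoc]
    refine mul_le_mul_of_nonneg_left ?_ (hV.rate_nonneg e)
    have h1 := hp x
    have h2 := hp (T e x)
    rw [div_sub_div _ _ h2.ne' h1.ne', div_le_div_iff₀ (by positivity) (by positivity)]
    have : (1 + ε * V x) * (ε * (V (T e x) - V x) ^ 2) ≥ 0 := by positivity
    nlinarith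
  refine key.trans ?_
  have h1 := hp x
  have h3 := hV.nonneg x
  have h4 := hV.growth_nonneg
  rw [← mul_div_assoc, div_le_div_iff₀ (by positivity) h1]
  have h5 := mul_le_mul_of_nonneg_right (hV.jumpGen_le x) h1.le
  have h6 : 0 ≤ C * V x * (1 + ε * V x) * (ε * V x) := by positivity
  nlinarith

end IsLyapunov

variable [MeasurableSpace E] [OpensMeasurableSpace E]

/-- A family of probability measures which solves the forward equation of the jump generator,
tested against the bounded continuous functions. -/
structure IsForwardSolution (w : J → ℝ) (T : J → C(E, E)) (ν : ℝ → Measure E) : Prop where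
  isProbabilityMeasure : ∀ s, IsProbabilityMeasure (ν s)
  hasDeriv : ∀ (f : E →ᵇ ℝ) (s : ℝ), 0 ≤ s →
    HasDerivWithinAt (fun r => ∫ x, f x ∂ν r) (∫ x, jumpGen w T f x ∂ν s) (Set.Ici 0) s

namespace IsForwardSolution

variable {ν : ℝ → Measure E} {V : E → ℝ} {C M : ℝ}

theorem integrable_bounded (hν : IsForwardSolution w T ν) (f : E →ᵇ ℝ) (s : ℝ) :
    Integrable f (ν s) :=
  have := hν.isProbabilityMeasure s
  f.integrable _

theorem integrable_jumpGen (hν : IsForwardSolution w T ν) (f : E →ᵇ ℝ) (s : ℝ) :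
    Integrable (jumpGen w T f) (ν s) := by
  have := hν.isProbabilityMeasure s
  unfold jumpGen
  refine integrable_finsetSum _ fun e _ => Integrable.const_mul ?_ _
  exact ((f.compContinuous (T e)).integrable (ν s)).sub (f.integrable (ν s))

/-- Grönwall applies to the bounded truncations of `V`, with a bound that does not depend on the
truncation, and Fatou removes the truncation. The lower integral is used because integrability of
`V` at time `s` is a consequence. -/
theorem lintegral_lyapunov_le (hν : IsForwardSolution w T ν) (hV : IsLyapunov w T V C M)
    (h0 : Integrable V (ν 0)) {s : ℝ} (hs : 0 ≤ s) :
    ∫⁻ x, ENNReal.ofReal (V x) ∂ν s ≤ ENNReal.ofReal (Real.exp (C * s) * ∫ x, V x ∂ν 0) := by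
  have hVb : ∀ x, |V x| ≤ 1 * V x := fun x => by rw [abs_of_nonneg (hV.nonneg x), one_mul]
  set F : ℕ → E →ᵇ ℝ := fun n =>
    hV.truncation hV.continuous zero_le_one hVb (Nat.one_div_pos_of_nat (α := ℝ) (n := n)) with hF
  have hFnonneg : ∀ n x, 0 ≤ F n x := fun n x => by
    have := hV.nonneg x
    simp only [hF, IsLyapunov.truncation_apply]
    positivity
  have hFle : ∀ n x, F n x ≤ V x := fun n x => by
    have := hV.abs_truncation_le hV.continuous zero_le_one hVb
      (Nat.one_div_pos_of_nat (α := ℝ) (n := n)) x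
    rw [one_mul] at this
    exact (le_abs_self _).trans this
  have hbound : ∀ n, ∫ x, F n x ∂ν s ≤ Real.exp (C * s) * ∫ x, V x ∂ν 0 := by
    intro n
    have hgr := le_gronwallBound_of_liminf_deriv_right_le (f := fun r => ∫ x, F n x ∂ν r)
      (f' := fun r => ∫ x, jumpGen w T (F n) x ∂ν r) (δ := ∫ x, V x ∂ν 0) (K := C) (ε := 0)
      (a := 0) (b := s)
      (fun r hr => ((hν.hasDeriv (F n) r hr.1).continuousWithinAt).mono fun y hy => hy.1)
      (fun r hr q hq => ((hν.hasDeriv (F n) r hr.1).mono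
        (Set.Ici_subset_Ici.2 hr.1)).liminf_right_slope_le hq)
      (integral_mono (hν.integrable_bounded (F n) 0) h0 (hFle n))
      (fun r _ => by
        rw [add_zero, ← integral_const_mul]
        refine integral_mono (hν.integrable_jumpGen (F n) r)
          ((hν.integrable_bounded (F n) r).const_mul C) fun x => ?_
        exact hV.jumpGen_truncation_le Nat.one_div_pos_of_nat x)
      s ⟨hs, le_rfl⟩
    rw [gronwallBound_ε0, sub_zero, mul_comm] at hgr
    exact hgr
  have hlim : ∀ x, ENNReal.ofReal (V x) = liminf (fun n => ENNReal.ofReal (F n x)) atTop :=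
    fun x => ((ENNReal.continuous_ofReal.tendsto _).comp
      (hV.tendsto_truncation hV.continuous zero_le_one hVb x)).liminf_eq.symm
  simp only [hlim]
  refine (lintegral_liminf_le fun n =>
    (ENNReal.measurable_ofReal.comp (F n).continuous.measurable)).trans ?_
  refine liminf_le_of_le (by isBoundedDefault) fun b hb => ?_
  obtain ⟨n, hn⟩ := hb.exists
  refine hn.trans ?_
  have h1 := ofReal_integral_eq_lintegral_ofReal (hν.integrable_bounded (F n) s)
    (Eventually.of_forall (hFnonneg n))
  refine h1.symm.le.trans ?_
  exact ENNReal.ofReal_le_ofReal (hbound n)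

theorem integrable_lyapunov (hν : IsForwardSolution w T ν) (hV : IsLyapunov w T V C M)
    (h0 : Integrable V (ν 0)) {s : ℝ} (hs : 0 ≤ s) : Integrable V (ν s) := by
  refine ⟨hV.continuous.measurable.aestronglyMeasurable, ?_⟩
  rw [hasFiniteIntegral_iff_ofReal (Eventually.of_forall hV.nonneg)]
  exact (hν.lintegral_lyapunov_le hV h0 hs).trans_lt ENNReal.ofReal_lt_top

theorem integral_lyapunov_le (hν : IsForwardSolution w T ν) (hV : IsLyapunov w T V C M)
    (h0 : Integrable V (ν 0)) {s : ℝ} (hs : 0 ≤ s) :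
    ∫ x, V x ∂ν s ≤ Real.exp (C * s) * ∫ x, V x ∂ν 0 := by
  have h := hν.lintegral_lyapunov_le hV h0 hs
  rw [← ofReal_integral_eq_lintegral_ofReal (hν.integrable_lyapunov hV h0 hs)
    (Eventually.of_forall hV.nonneg)] at h
  exact (ENNReal.ofReal_le_ofReal_iff
    (mul_nonneg (Real.exp_nonneg _) (integral_nonneg hV.nonneg))).1 h

theorem integrable_of_le (hν : IsForwardSolution w T ν) (hV : IsLyapunov w T V C M)
    (h0 : Integrable V (ν 0)) {h : E → ℝ} (hc : Continuous h) {A : ℝ}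
    (hh : ∀ x, |h x| ≤ A * V x) {s : ℝ} (hs : 0 ≤ s) : Integrable h (ν s) :=
  ((hν.integrable_lyapunov hV h0 hs).const_mul A).mono'
    hc.measurable.aestronglyMeasurable (Eventually.of_forall hh)

theorem abs_integral_le (hν : IsForwardSolution w T ν) (hV : IsLyapunov w T V C M)
    (h0 : Integrable V (ν 0)) {h : E → ℝ} {A : ℝ} (hA : 0 ≤ A)
    (hh : ∀ x, |h x| ≤ A * V x) {s t : ℝ} (hs : 0 ≤ s) (hst : s ≤ t) :
    |∫ x, h x ∂ν s| ≤ A * (Real.exp (C * t) * ∫ x, V x ∂ν 0) := by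
  have h1 := norm_integral_le_of_norm_le ((hν.integrable_lyapunov hV h0 hs).const_mul A)
    (f := h) (Eventually.of_forall hh)
  rw [integral_const_mul, Real.norm_eq_abs] at h1
  refine h1.trans (mul_le_mul_of_nonneg_left ?_ hA)
  refine (hν.integral_lyapunov_le hV h0 hs).trans
    (mul_le_mul_of_nonneg_right ?_ (integral_nonneg hV.nonneg))
  exact Real.exp_le_exp.2 (mul_le_mul_of_nonneg_left hst hV.growth_nonneg)

/-- The forward equation in integrated form, for functions dominated by a Lyapunov function. -/
theorem integral_sub_eq (hν : IsForwardSolution w T ν) (hV : IsLyapunov w T V C M)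
    (h0 : Integrable V (ν 0)) {h : E → ℝ} (hc : Continuous h) {A : ℝ} (hA : 0 ≤ A)
    (hh : ∀ x, |h x| ≤ A * V x) {s t : ℝ} (hs : 0 ≤ s) (hst : s ≤ t) :
    ∫ r in s..t, ∫ x, jumpGen w T h x ∂ν r = ∫ x, h x ∂ν t - ∫ x, h x ∂ν s := by
  set F : ℕ → E →ᵇ ℝ := fun n =>
    hV.truncation hc hA hh (Nat.one_div_pos_of_nat (α := ℝ) (n := n)) with hF
  have hFle : ∀ n x, |F n x| ≤ A * V x := fun n x => hV.abs_truncation_le hc hA hh _ x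
  have hFlim : ∀ x, Tendsto (fun n => F n x) atTop (𝓝 (h x)) := hV.tendsto_truncation hc hA hh
  -- One domination constant for the generators of all truncations; the factor `M` is needed because
  -- the generator evaluates functions after a jump.
  set A' : ℝ := ∑ e, w e * (M + 1) * A with hA'
  have hA'0 : 0 ≤ A' := Finset.sum_nonneg fun e _ =>
    mul_nonneg (mul_nonneg (hV.rate_nonneg e) (by linarith [hV.factor_nonneg])) hA
  have hGle : ∀ n x, |jumpGen w T (F n) x| ≤ A' * V x := fun n =>
    hV.abs_jumpGen_le hA (hFle n)
  have hcont : ∀ n, ContinuousOn (fun r => ∫ x, jumpGen w T (F n) x ∂ν r) (Set.Ici 0) := by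
    intro n
    -- The generator of a bounded continuous function is again one, so the forward equation for `G`
    -- gives continuity in time.
    let G : E →ᵇ ℝ := ∑ e, w e • ((F n).compContinuous (T e) - F n)
    have hG : jumpGen w T (F n) = G := by
      ext x
      simp [G, jumpGen, BoundedContinuousFunction.coe_sum]
    simp only [hG]
    exact fun r hr => (hν.hasDeriv G r hr).continuousWithinAt
  have hsub : Set.uIcc s t ⊆ Set.Ici 0 := by
    rw [Set.uIcc_of_le hst]
    exact fun r hr => hs.trans hr.1
  have hF_eq : ∀ n, ∫ r in s..t, ∫ x, jumpGen w T (F n) x ∂ν r =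
      ∫ x, F n x ∂ν t - ∫ x, F n x ∂ν s := by
    intro n
    refine intervalIntegral.integral_eq_sub_of_hasDeriv_right
      (f := fun r => ∫ x, F n x ∂ν r) (fun r hr => ?_) (fun r hr => ?_) ?_
    · exact (hν.hasDeriv (F n) r (hsub hr)).continuousWithinAt.mono hsub
    · rw [min_eq_left hst, max_eq_right hst] at hr
      exact (hν.hasDeriv (F n) r (hs.trans hr.1.le)).mono fun y hy =>
        hs.trans (hr.1.le.trans (le_of_lt hy))
    · exact ((hcont n).mono hsub).intervalIntegrable
  have hlim : ∀ r, 0 ≤ r → Tendsto (fun n => ∫ x, F n x ∂ν r) atTop (𝓝 (∫ x, h x ∂ν r)) :=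
    fun r hr => tendsto_integral_of_dominated_convergence (fun x => A * V x)
      (fun n => (hν.integrable_bounded (F n) r).aestronglyMeasurable)
      ((hν.integrable_lyapunov hV h0 hr).const_mul A)
      (fun n => Eventually.of_forall (hFle n)) (Eventually.of_forall hFlim)
  have hlim' : ∀ r, 0 ≤ r → Tendsto (fun n => ∫ x, jumpGen w T (F n) x ∂ν r) atTop
      (𝓝 (∫ x, jumpGen w T h x ∂ν r)) :=
    fun r hr => tendsto_integral_of_dominated_convergence (fun x => A' * V x)
      (fun n => (hν.integrable_jumpGen (F n) r).aestronglyMeasurable)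
      ((hν.integrable_lyapunov hV h0 hr).const_mul A')
      (fun n => Eventually.of_forall (hGle n))
      (Eventually.of_forall fun x => by
        unfold jumpGen
        exact tendsto_finsetSum _ fun e _ => ((hFlim _).sub (hFlim _)).const_mul _)
  have hsub' : Set.uIoc s t ⊆ Set.uIcc s t := Set.uIoc_subset_uIcc
  -- Second passage to the limit, now in time; the exponential moment bound for `V` supplies a
  -- constant majorant on `[s, t]`.
  have hconv := intervalIntegral.tendsto_integral_filter_of_dominated_convergence
    (μ := volume) (a := s) (b := t) (l := atTop)
    (F := fun n r => ∫ x, jumpGen w T (F n) x ∂ν r) (f := fun r => ∫ x, jumpGen w T h x ∂ν r)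
    (fun _ => A' * (Real.exp (C * t) * ∫ x, V x ∂ν 0))
    (Eventually.of_forall fun n =>
      (((hcont n).mono (hsub'.trans hsub)).aestronglyMeasurable measurableSet_uIoc))
    (Eventually.of_forall fun n => Eventually.of_forall fun r hr => by
      have hr' := hsub' hr
      rw [Set.uIcc_of_le hst] at hr'
      exact hν.abs_integral_le hV h0 hA'0 (hGle n) (hs.trans hr'.1) hr'.2)
    intervalIntegrable_const
    (Eventually.of_forall fun r hr => hlim' r (hsub (hsub' hr)))
  simp only [hF_eq] at hconv
  exact tendsto_nhds_unique hconv ((hlim t (hs.trans hst)).sub (hlim s hs))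

/-- The integrated equation makes these integrals locally Lipschitz in time. Applied to `jumpGen w T
h`, this is what allows the integrated equation to be differentiated. -/
theorem continuousOn_integral (hν : IsForwardSolution w T ν) (hV : IsLyapunov w T V C M)
    (h0 : Integrable V (ν 0)) {h : E → ℝ} (hc : Continuous h) {A : ℝ} (hA : 0 ≤ A)
    (hh : ∀ x, |h x| ≤ A * V x) : ContinuousOn (fun s => ∫ x, h x ∂ν s) (Set.Ici 0) := by
  set A' : ℝ := ∑ e, w e * (M + 1) * A with hA'
  have hA'0 : 0 ≤ A' := Finset.sum_nonneg fun e _ =>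
    mul_nonneg (mul_nonneg (hV.rate_nonneg e) (by linarith [hV.factor_nonneg])) hA
  have hLip : ∀ b, ∀ r ∈ Set.Icc (0 : ℝ) b, ∀ s ∈ Set.Icc (0 : ℝ) b, r ≤ s →
      |∫ x, h x ∂ν s - ∫ x, h x ∂ν r| ≤ A' * (Real.exp (C * b) * ∫ x, V x ∂ν 0) * |s - r| := by
    intro b r hr s hs hrs
    rw [← hν.integral_sub_eq hV h0 hc hA hh hr.1 hrs]
    refine intervalIntegral.norm_integral_le_of_norm_le_const (E := ℝ) fun y hy => ?_
    rw [Set.uIoc_of_le hrs] at hy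
    exact hν.abs_integral_le hV h0 hA'0 (hV.abs_jumpGen_le hA hh) (hr.1.trans hy.1.le)
      (hy.2.trans hs.2)
  intro s hs
  set B := A' * (Real.exp (C * (s + 1)) * ∫ x, V x ∂ν 0) with hB
  have hs' : s ∈ Set.Icc (0 : ℝ) (s + 1) := ⟨hs, by linarith⟩
  have hev : ∀ᶠ r in 𝓝[Set.Ici 0] s, dist (∫ x, h x ∂ν r) (∫ x, h x ∂ν s) ≤ B * dist r s := by
    filter_upwards [self_mem_nhdsWithin,
      mem_nhdsWithin_of_mem_nhds (Iic_mem_nhds (show s < s + 1 by linarith))] with r hr hr'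
    rcases le_total r s with hrs | hrs
    · rw [dist_comm, dist_comm r]
      exact hLip (s + 1) r ⟨hr, hr'⟩ s hs' hrs
    · exact hLip (s + 1) s hs' r ⟨hr, hr'⟩ hrs
  refine tendsto_iff_dist_tendsto_zero.2 (squeeze_zero' (Eventually.of_forall fun _ => dist_nonneg)
    hev ?_)
  have : Tendsto (fun r => B * dist r s) (𝓝 s) (𝓝 (B * dist s s)) :=
    (continuous_const.mul (continuous_id.dist continuous_const)).tendsto s
  rw [dist_self, mul_zero] at this
  exact this.mono_left nhdsWithin_le_nhds

/-- The forward equation, for functions dominated by a Lyapunov function. -/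
theorem hasDerivWithinAt_integral (hν : IsForwardSolution w T ν) (hV : IsLyapunov w T V C M)
    (h0 : Integrable V (ν 0)) {h : E → ℝ} (hc : Continuous h) {A : ℝ} (hA : 0 ≤ A)
    (hh : ∀ x, |h x| ≤ A * V x) {s : ℝ} (hs : 0 ≤ s) :
    HasDerivWithinAt (fun r => ∫ x, h x ∂ν r) (∫ x, jumpGen w T h x ∂ν s) (Set.Ici 0) s := by
  have hA'0 : 0 ≤ ∑ e, w e * (M + 1) * A := Finset.sum_nonneg fun e _ =>
    mul_nonneg (mul_nonneg (hV.rate_nonneg e) (by linarith [hV.factor_nonneg])) hA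
  set g : ℝ → ℝ := fun r => ∫ x, jumpGen w T h x ∂ν r with hg
  have hgc : ContinuousOn g (Set.Ici 0) :=
    hν.continuousOn_integral hV h0 (continuous_jumpGen hc) hA'0 (hV.abs_jumpGen_le hA hh)
  -- Freezing `g` at negative times gives a continuous function on the whole line, so the two-sided
  -- fundamental theorem also covers `s = 0`.
  have hG : Continuous fun r => g (max r 0) :=
    hgc.comp_continuous (continuous_id.max continuous_const) fun r => Set.mem_Ici.2 (le_max_right _ _)
  have hd := ((hG.integral_hasStrictDerivAt 0 s).hasDerivAt.const_add
    (∫ x, h x ∂ν 0)).hasDerivWithinAt (s := Set.Ici 0)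
  rw [max_eq_left hs] at hd
  have heq : ∀ r ∈ Set.Ici (0 : ℝ), ∫ x, h x ∂ν r =
      ∫ x, h x ∂ν 0 + ∫ y in (0 : ℝ)..r, g (max y 0) := by
    intro r hr
    have h1 := hν.integral_sub_eq hV h0 hc hA hh le_rfl hr
    have h2 : ∫ y in (0 : ℝ)..r, g (max y 0) = ∫ y in (0 : ℝ)..r, g y := by
      refine intervalIntegral.integral_congr fun y hy => ?_
      rw [Set.uIcc_of_le hr] at hy
      simp only [max_eq_left hy.1]
    rw [h2, h1]
    ring
  exact hd.congr heq (heq s hs)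

/-- The derivative of the second moment of a linear combination with moving coefficients. -/
theorem hasDerivWithinAt_integral_sq (hν : IsForwardSolution w T ν) (hV : IsLyapunov w T V C M)
    (h0 : Integrable V (ν 0)) {ι : Type*} [Fintype ι] {h : ι → E → ℝ}
    (hc : ∀ k, Continuous (h k)) {A : ℝ} (hA : 0 ≤ A)
    (hh : ∀ k l x, |h k x * h l x| ≤ A * V x) {c c' : ι → ℝ → ℝ} {s : ℝ} (hs : 0 ≤ s)
    (hcd : ∀ k, HasDerivAt (c k) (c' k s) s) :
    HasDerivWithinAt (fun r => ∫ x, (∑ k, c k r * h k x) ^ 2 ∂ν r)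
      (∫ x, (2 * (∑ k, c k s * h k x) * (∑ k, c' k s * h k x) +
        jumpGen w T (fun y => (∑ k, c k s * h k y) ^ 2) x) ∂ν s) (Set.Ici 0) s := by
  have hcc : ∀ k l, Continuous fun x => h k x * h l x := fun k l => (hc k).mul (hc l)
  have hint : ∀ k l r, 0 ≤ r → Integrable (fun x => h k x * h l x) (ν r) := fun k l r hr =>
    hν.integrable_of_le hV h0 (hcc k l) (hh k l) hr
  have hintG : ∀ k l, Integrable (jumpGen w T fun x => h k x * h l x) (ν s) := fun k l =>
    hν.integrable_of_le hV h0 (continuous_jumpGen (hcc k l)) (hV.abs_jumpGen_le hA (hh k l)) hs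
  -- The forward equation needs test functions that do not move. Expanding into products puts all
  -- the time dependence into scalar coefficients.
  have hsq : ∀ r x, (∑ k, c k r * h k x) ^ 2 =
      ∑ p : ι × ι, (c p.1 r * c p.2 r) * (h p.1 x * h p.2 x) := by
    intro r x
    rw [sq, Finset.sum_mul_sum, Fintype.sum_prod_type]
    refine Finset.sum_congr rfl fun k _ => Finset.sum_congr rfl fun l _ => ?_
    ring
  have hprod : ∀ x, 2 * (∑ k, c k s * h k x) * (∑ k, c' k s * h k x) =
      ∑ p : ι × ι, (c' p.1 s * c p.2 s + c p.1 s * c' p.2 s) * (h p.1 x * h p.2 x) := by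
    intro x
    have h1 : 2 * (∑ k, c k s * h k x) * (∑ k, c' k s * h k x) =
        (∑ k, c' k s * h k x) * (∑ k, c k s * h k x) +
          (∑ k, c k s * h k x) * (∑ k, c' k s * h k x) := by ring
    rw [h1, Finset.sum_mul_sum, Finset.sum_mul_sum, Fintype.sum_prod_type,
      ← Finset.sum_add_distrib]
    refine Finset.sum_congr rfl fun k _ => ?_
    rw [← Finset.sum_add_distrib]
    refine Finset.sum_congr rfl fun l _ => ?_
    ring
  have hmain : HasDerivWithinAt
      (fun r => ∑ p : ι × ι, (c p.1 r * c p.2 r) * ∫ x, h p.1 x * h p.2 x ∂ν r)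
      (∑ p : ι × ι, ((c' p.1 s * c p.2 s + c p.1 s * c' p.2 s) * (∫ x, h p.1 x * h p.2 x ∂ν s) +
        (c p.1 s * c p.2 s) * ∫ x, jumpGen w T (fun y => h p.1 y * h p.2 y) x ∂ν s))
      (Set.Ici 0) s := by
    refine HasDerivWithinAt.fun_sum fun p _ => ?_
    exact ((hcd p.1).mul (hcd p.2)).hasDerivWithinAt.mul
      (hν.hasDerivWithinAt_integral hV h0 (hcc p.1 p.2) hA (hh p.1 p.2) hs)
  have hval : (∫ x, (2 * (∑ k, c k s * h k x) * (∑ k, c' k s * h k x) +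
        jumpGen w T (fun y => (∑ k, c k s * h k y) ^ 2) x) ∂ν s) =
      ∑ p : ι × ι, ((c' p.1 s * c p.2 s + c p.1 s * c' p.2 s) * (∫ x, h p.1 x * h p.2 x ∂ν s) +
        (c p.1 s * c p.2 s) * ∫ x, jumpGen w T (fun y => h p.1 y * h p.2 y) x ∂ν s) := by
    simp only [hsq, hprod, jumpGen_sum, ← Finset.sum_add_distrib]
    rw [integral_finsetSum]
    · refine Finset.sum_congr rfl fun p _ => ?_
      rw [integral_add ((hint _ _ s hs).const_mul _) ((hintG _ _).const_mul _),
        integral_const_mul, integral_const_mul]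
    · exact fun p _ => ((hint _ _ s hs).const_mul _).add ((hintG _ _).const_mul _)
  rw [hval]
  have heq : ∀ r ∈ Set.Ici (0 : ℝ), ∫ x, (∑ k, c k r * h k x) ^ 2 ∂ν r =
      ∑ p : ι × ι, (c p.1 r * c p.2 r) * ∫ x, h p.1 x * h p.2 x ∂ν r := by
    intro r hr
    simp only [hsq]
    rw [integral_finsetSum _ fun p _ => (hint _ _ r hr).const_mul _]
    simp only [integral_const_mul]
  exact hmain.congr heq (heq s hs)

end IsForwardSolution

end JumpGenerator

/-! ### Riemann sums over the sites. -/

theorem integral_unitInterval_eq (g : C(I, ℝ)) :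
    ∫ v : I, g v = ∫ x in (0 : ℝ)..1, g (Set.projIcc 0 1 zero_le_one x) := by
  have h := integral_subtype (s := Set.Icc (0 : ℝ) 1) measurableSet_Icc
    (fun x : ℝ => g (Set.projIcc 0 1 zero_le_one x))
  rw [intervalIntegral.integral_of_le zero_le_one, ← integral_Icc_eq_integral_Ioc, ← h]
  refine integral_congr_ae (Eventually.of_forall fun v => ?_)
  simp only [Set.projIcc_val]

/-- `site j` is the right endpoint of the cell `[j/N, (j+1)/N]`, so each of the `N` cells
contributes an error of at most `ε / N`. -/
theorem abs_average_site_sub_integral_le {N : ℕ} (hN : N ≠ 0) (g : C(I, ℝ)) {ε : ℝ}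
    (hg : ∀ u v : I, |(u : ℝ) - v| ≤ 1 / N → |g u - g v| ≤ ε) :
    |(1 / (N : ℝ)) * ∑ j : Fin N, g (site j) - ∫ v : I, g v| ≤ ε := by
  have hN0 : (0 : ℝ) < N := by exact_mod_cast Nat.pos_of_ne_zero hN
  set G : ℝ → ℝ := fun x => g (Set.projIcc 0 1 zero_le_one x) with hG
  have hGc : Continuous G := g.continuous.comp continuous_projIcc
  have hsum : ∑ k ∈ Finset.range N, ∫ x in ((k : ℕ) / N : ℝ)..((k + 1 : ℕ) / N : ℝ), G x =
      ∫ v : I, g v := by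
    rw [intervalIntegral.sum_integral_adjacent_intervals (a := fun k : ℕ => (k / N : ℝ))
      fun k _ => hGc.intervalIntegrable _ _, integral_unitInterval_eq]
    simp [hN0.ne', hG]
  rw [← hsum, Finset.sum_range, Finset.mul_sum, ← Finset.sum_sub_distrib]
  refine (Finset.abs_sum_le_sum_abs _ _).trans ?_
  have hterm : ∀ j : Fin N, |1 / (N : ℝ) * g (site j) -
      ∫ x in ((j : ℕ) / N : ℝ)..(((j : ℕ) + 1 : ℕ) / N : ℝ), G x| ≤ ε * (1 / N) := by
    intro j
    have hlen : (((j : ℕ) + 1 : ℕ) / N : ℝ) - ((j : ℕ) / N : ℝ) = 1 / N := by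
      push_cast
      ring
    have hconst : 1 / (N : ℝ) * g (site j) =
        ∫ _ in ((j : ℕ) / N : ℝ)..(((j : ℕ) + 1 : ℕ) / N : ℝ), g (site j) := by
      rw [intervalIntegral.integral_const, hlen, smul_eq_mul]
    have hle : ((j : ℕ) / N : ℝ) ≤ (((j : ℕ) + 1 : ℕ) / N : ℝ) := by
      have : 0 ≤ 1 / (N : ℝ) := by positivity
      linarith
    rw [hconst, ← intervalIntegral.integral_sub intervalIntegrable_const
      (hGc.intervalIntegrable _ _)]
    have h1 := intervalIntegral.norm_integral_le_of_norm_le_const (C := ε)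
      (f := fun x => g (site j) - G x) (a := ((j : ℕ) / N : ℝ))
      (b := (((j : ℕ) + 1 : ℕ) / N : ℝ)) (fun x hx => by
        rw [Set.uIoc_of_le hle] at hx
        have hx01 : x ∈ Set.Icc (0 : ℝ) 1 := by
          refine ⟨le_trans (by positivity) hx.1.le, hx.2.trans ?_⟩
          rw [div_le_one hN0]
          exact_mod_cast j.isLt
        rw [Real.norm_eq_abs]
        refine hg _ _ ?_
        rw [Set.projIcc_of_mem zero_le_one hx01]
        have hs : ((site j : I) : ℝ) = (((j : ℕ) + 1 : ℕ) / N : ℝ) := by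
          simp [site]
        rw [hs, abs_of_nonneg (by simpa using hx.2)]
        simp only
        linarith [hx.1])
    rwa [hlen, abs_of_nonneg (by positivity)] at h1
  refine (Finset.sum_le_sum fun j _ => hterm j).trans ?_
  simp only [Finset.sum_const, Finset.card_univ, Fintype.card_fin, nsmul_eq_mul]
  field_simp
  exact le_rfl

/-- Averages over the sites converge to integrals, uniformly in a compact parameter space. -/
theorem eventually_abs_average_site_sub_integral_le {Y : Type*} [PseudoMetricSpace Y]
    [CompactSpace Y] (G : Y → I → ℝ) (hG : Continuous fun p : Y × I => G p.1 p.2) {ε : ℝ}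
    (hε : 0 < ε) :
    ∀ᶠ N : ℕ in atTop, ∀ y,
      |(1 / (N : ℝ)) * ∑ j : Fin N, G y (site j) - ∫ v : I, G y v| ≤ ε := by
  obtain ⟨δ, hδ, h⟩ := Metric.uniformContinuous_iff.1
    (CompactSpace.uniformContinuous_of_continuous hG) ε hε
  filter_upwards [(tendsto_one_div_atTop_nhds_zero_nat (𝕜 := ℝ)).eventually (gt_mem_nhds hδ),
    eventually_ne_atTop 0] with N hN hN0 y
  refine abs_average_site_sub_integral_le hN0 ⟨G y, by fun_prop⟩ fun u v huv => ?_
  have h1 : dist (y, u) (y, v) < δ := by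
    rw [Prod.dist_eq, dist_self, max_eq_right dist_nonneg, Subtype.dist_eq, Real.dist_eq]
    exact huv.trans_lt hN
  exact (Real.dist_eq _ _ ▸ h h1).le

theorem tendsto_average_site (g : C(I, ℝ)) :
    Tendsto (fun N : ℕ => (1 / (N : ℝ)) * ∑ j : Fin N, g (site j)) atTop
      (𝓝 (∫ v : I, g v)) := by
  rw [Metric.tendsto_nhds]
  intro ε hε
  filter_upwards [eventually_abs_average_site_sub_integral_le (Y := Unit) (fun _ => g) (by fun_prop)
    (half_pos hε)] with N hN
  rw [Real.dist_eq]
  exact (hN ()).trans_lt (half_lt_self hε)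

/-! ### Linear differential equations with bounded operators. -/

section LinearODE

variable {F : Type*} [NormedAddCommGroup F] [NormedSpace ℝ F]

theorem linearODE_unique (A : F →L[ℝ] F) {y z : ℝ → F}
    (hy : ∀ t, 0 ≤ t → HasDerivWithinAt y (A (y t)) (Set.Ici 0) t)
    (hz : ∀ t, 0 ≤ t → HasDerivWithinAt z (A (z t)) (Set.Ici 0) t) (h0 : y 0 = z 0) :
    Set.EqOn y z (Set.Ici 0) := by
  intro t ht
  have hcont : ∀ {x : ℝ → F}, (∀ t, 0 ≤ t → HasDerivWithinAt x (A (x t)) (Set.Ici 0) t) →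
      ContinuousOn x (Set.Icc 0 t) := fun hx r hr =>
    (hx r hr.1).continuousWithinAt.mono fun q hq => hq.1
  exact ODE_solution_unique (v := fun _ => A) (K := ‖A‖₊) (fun _ => A.lipschitz) (hcont hy)
    (fun r hr => (hy r hr.1).mono (Set.Ici_subset_Ici.2 hr.1)) (hcont hz)
    (fun r hr => (hz r hr.1).mono (Set.Ici_subset_Ici.2 hr.1)) h0 ⟨ht, le_rfl⟩

theorem expOp_zero_smul (A : F →L[ℝ] F) : expOp ((0 : ℝ) • A) = ContinuousLinearMap.id ℝ F := by
  rw [zero_smul]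
  exact NormedSpace.exp_zero

theorem hasDerivWithinAt_clm_comp {G : Type*} [NormedAddCommGroup G] [NormedSpace ℝ G]
    (A : F →L[ℝ] G) {y : ℝ → F} {y' : F} {s : Set ℝ} {t : ℝ} (h : HasDerivWithinAt y y' s t) :
    HasDerivWithinAt (fun r => A (y r)) (A y') s t :=
  A.hasFDerivAt.comp_hasDerivWithinAt t h

variable [CompleteSpace F]

theorem hasDerivAt_expOp_smul (A : F →L[ℝ] F) (t : ℝ) :
    HasDerivAt (fun s : ℝ => expOp (s • A)) ((expOp (t • A)).comp A) t :=
  hasDerivAt_exp_smul_const A t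

theorem hasDerivAt_expOp_smul' (A : F →L[ℝ] F) (t : ℝ) :
    HasDerivAt (fun s : ℝ => expOp (s • A)) (A.comp (expOp (t • A))) t :=
  hasDerivAt_exp_smul_const' A t

theorem hasDerivAt_expOp_smul_apply (A : F →L[ℝ] F) (x : F) (t : ℝ) :
    HasDerivAt (fun s : ℝ => expOp (s • A) x) (A (expOp (t • A) x)) t :=
  (ContinuousLinearMap.apply ℝ F x).hasFDerivAt.comp_hasDerivAt t (hasDerivAt_expOp_smul' A t)

theorem hasDerivAt_expOp_sub_smul_apply (A : F →L[ℝ] F) (x : F) (T t : ℝ) :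
    HasDerivAt (fun s : ℝ => expOp ((T - s) • A) x) (-A (expOp ((T - t) • A) x)) t := by
  have h := (hasDerivAt_expOp_smul_apply A x (T - t)).scomp t ((hasDerivAt_id t).const_sub T)
  rw [neg_one_smul] at h
  exact h

theorem hasDerivAt_expOp_smul_apply' (A : F →L[ℝ] F) (x : F) (t : ℝ) :
    HasDerivAt (fun s : ℝ => expOp (s • A) x) (expOp (t • A) (A x)) t :=
  (ContinuousLinearMap.apply ℝ F x).hasFDerivAt.comp_hasDerivAt t (hasDerivAt_expOp_smul A t)

theorem hasDerivAt_comp_expOp_smul (A : F →L[ℝ] F) (m : F →L[ℝ] ℝ) (t : ℝ) :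
    HasDerivAt (fun s : ℝ => m.comp (expOp (s • A))) ((m.comp (expOp (t • A))).comp A) t :=
  (ContinuousLinearMap.compL ℝ F F ℝ m).hasFDerivAt.comp_hasDerivAt t (hasDerivAt_expOp_smul A t)

end LinearODE

/-! ### The limiting equations and their duality. -/

/-- The functional `f ↦ ∫₀¹ g(u) f(u) du` on `C[0,1]`, depending linearly on `g`. -/
def densityFunctional : C(I, ℝ) →L[ℝ] (C(I, ℝ) →L[ℝ] ℝ) :=
  (ContinuousLinearMap.compL ℝ C(I, ℝ) C(I, ℝ) ℝ
    -- `integralOp 1` produces constant functions, so the evaluation point `0` is arbitrary.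
    ((ContinuousMap.evalCLM ℝ (0 : I)).comp (integralOp 1))).comp
      (ContinuousLinearMap.mul ℝ C(I, ℝ))

theorem densityFunctional_apply (g f : C(I, ℝ)) : densityFunctional g f = ∫ u : I, g u * f u := by
  simp [densityFunctional, integralOp_apply]

/-- Fubini: transposing an integral operator swaps the arguments of its kernel. -/
theorem integral_integralOp_mul (k : C(I × I, ℝ)) (g f : C(I, ℝ)) :
    ∫ u : I, integralOp k g u * f u =
      ∫ u : I, g u * integralOp (k.comp ⟨Prod.swap, continuous_swap⟩) f u := by
  simp only [integralOp_apply, ← integral_mul_const, ← integral_const_mul]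
  rw [integral_integral_swap]
  · refine integral_congr_ae (Eventually.of_forall fun v => integral_congr_ae
      (Eventually.of_forall fun u => ?_))
    simp only [ContinuousMap.comp_apply, ContinuousMap.coe_mk, Prod.swap_prod_mk]
    ring
  · exact (by fun_prop : Continuous fun p : I × I =>
      k (p.1, p.2) * g p.2 * f p.1).integrable_of_hasCompactSupport
        (HasCompactSupport.of_compactSpace _)

namespace UrnCoefficients

variable (κ : UrnCoefficients)

/-- The density operator is dual to `P₁`. -/
theorem densityFunctional_densityOp (g : C(I, ℝ)) :
    densityFunctional (κ.densityOp g) = (densityFunctional g).comp κ.opP₁ := by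
  ext f
  have hi : ∀ k l : C(I, ℝ), Integrable (fun u : I => k u * l u) := fun k l =>
    (by fun_prop : Continuous _).integrable_of_hasCompactSupport
      (HasCompactSupport.of_compactSpace _)
  rw [ContinuousLinearMap.comp_apply, densityFunctional_apply, densityFunctional_apply]
  simp only [densityOp, opP₁, add_apply, ContinuousMap.add_apply,
    ContinuousLinearMap.mul_apply', ContinuousMap.mul_apply, add_mul, mul_add]
  have h1 := integral_add (hi (κ.rate * g) f) (hi (integralOp ⟨fun p => (κ.lam p : ℝ) *
    (κ.a₂ p : ℝ) + (κ.lam p.swap : ℝ) * (κ.a₃ p.swap : ℝ), by fun_prop⟩ g) f)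
  have h2 := integral_add (hi g (κ.rate * f)) (hi g (integralOp ⟨fun p => (κ.lam p : ℝ) *
    (κ.a₃ p : ℝ) + (κ.lam p.swap : ℝ) * (κ.a₂ p.swap : ℝ), by fun_prop⟩ f))
  -- The two operators share the multiplication part, and their kernels are transposes of each
  -- other.
  have hk : (⟨fun p => (κ.lam p : ℝ) * (κ.a₂ p : ℝ) + (κ.lam p.swap : ℝ) * (κ.a₃ p.swap : ℝ),
      by fun_prop⟩ : C(I × I, ℝ)).comp ⟨Prod.swap, continuous_swap⟩ =
      ⟨fun p => (κ.lam p : ℝ) * (κ.a₃ p : ℝ) + (κ.lam p.swap : ℝ) * (κ.a₂ p.swap : ℝ),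
        by fun_prop⟩ := by
    ext p
    simp [add_comm]
  rw [integral_integralOp_mul, hk] at h1
  refine h1.trans (Eq.trans ?_ h2.symm)
  congr 1
  refine integral_congr_ae (Eventually.of_forall fun u => ?_)
  simp only [ContinuousMap.mul_apply]
  ring

/-- The solution `μ_t = μ_0 ∘ exp(t P₁)` of the hydrodynamic equation. -/
def hydrodynamic (φ : C(I, ℝ)) (t : ℝ) : C(I, ℝ) →L[ℝ] ℝ :=
  (densityFunctional φ).comp (expOp (t • κ.opP₁))

/-- The solution `ρ_t` of the equation for the density. -/
def density (φ : C(I, ℝ)) (t : ℝ) : C(I, ℝ) := expOp (t • κ.densityOp) φ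

theorem isHydrodynamicSolution_hydrodynamic (φ : C(I, ℝ)) :
    κ.IsHydrodynamicSolution φ (κ.hydrodynamic φ) where
  deriv t _ := (hasDerivAt_comp_expOp_smul κ.opP₁ _ t).hasDerivWithinAt
  init f := by
    rw [hydrodynamic, expOp_zero_smul, ContinuousLinearMap.comp_id, densityFunctional_apply]

theorem isDensitySolution_density (φ : C(I, ℝ)) :
    κ.IsDensitySolution φ (κ.density φ) where
  deriv t _ := (hasDerivAt_expOp_smul_apply κ.densityOp φ t).hasDerivWithinAt
  init := by rw [density, expOp_zero_smul, ContinuousLinearMap.id_apply]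

variable {κ}

theorem IsHydrodynamicSolution.eqOn {φ : C(I, ℝ)} {μ μ' : ℝ → (C(I, ℝ) →L[ℝ] ℝ)}
    (h' : κ.IsHydrodynamicSolution φ μ') (h : κ.IsHydrodynamicSolution φ μ) :
    Set.EqOn μ' μ (Set.Ici 0) :=
  linearODE_unique ((ContinuousLinearMap.compL ℝ C(I, ℝ) C(I, ℝ) ℝ).flip κ.opP₁) h'.deriv h.deriv
    (by ext f; rw [h'.init, h.init])

theorem IsDensitySolution.eqOn {φ : C(I, ℝ)} {ρ ρ' : ℝ → C(I, ℝ)}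
    (h' : κ.IsDensitySolution φ ρ') (h : κ.IsDensitySolution φ ρ) :
    Set.EqOn ρ' ρ (Set.Ici 0) :=
  linearODE_unique κ.densityOp h'.deriv h.deriv (by rw [h'.init, h.init])

/-- A bounded linear map commutes with the derivative, and duality turns the density operator into
`P₁^*`. Together with uniqueness this identifies `μ_t` with `ρ_t(u) du`. -/
theorem IsDensitySolution.isHydrodynamicSolution {φ : C(I, ℝ)} {ρ : ℝ → C(I, ℝ)}
    (h : κ.IsDensitySolution φ ρ) :
    κ.IsHydrodynamicSolution φ fun t => densityFunctional (ρ t) where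
  deriv t ht := by
    rw [← densityFunctional_densityOp]
    exact hasDerivWithinAt_clm_comp (G := C(I, ℝ) →L[ℝ] ℝ) densityFunctional (h.deriv t ht)
  init f := by rw [h.init, densityFunctional_apply]

end UrnCoefficients

/-! ### The urn system as a jump process, and its Lyapunov function. -/

namespace UrnCoefficients

variable (κ : UrnCoefficients)

/-- The rates of the jumps of the `N`-urn system; the pairs `(i, i)` have the rate zero. -/
def jumpRate (N : ℕ) : Fin N ⊕ (Fin N × Fin N) → ℝ
  | .inl i => κ.b (site i)
  | .inr p => if p.1 = p.2 then 0 else κ.lam (site p.1, site p.2) / N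

/-- The jumps of the `N`-urn system. -/
def jumpMap (N : ℕ) : Fin N ⊕ (Fin N × Fin N) → C(Config N, Config N)
  | .inl i => κ.selfJump i
  | .inr p => κ.pairJump p.1 p.2

variable {N : ℕ}

theorem jumpGen_urn (h : Config N → ℝ) (x : Config N) :
    jumpGen (κ.jumpRate N) (κ.jumpMap N) h x =
      (∑ i : Fin N, (κ.b (site i) : ℝ) * (h (κ.selfJump i x) - h x)) +
        ∑ i : Fin N, ∑ j : Fin N, (if i = j then 0 else (κ.lam (site i, site j) : ℝ) / N) *
          (h (κ.pairJump i j x) - h x) := by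
  simp only [jumpGen, Fintype.sum_sum_type, Fintype.sum_prod_type, jumpRate, jumpMap]

theorem generator_eq_jumpGen (f : Config N →ᵇ ℝ) (x : Config N) :
    κ.generator N f x = jumpGen (κ.jumpRate N) (κ.jumpMap N) f x := by
  rw [generator_apply, jumpGen_urn, Finset.mul_sum]
  congr 1
  refine Finset.sum_congr rfl fun i _ => ?_
  rw [← Finset.add_sum_erase _ _ (Finset.mem_univ i), if_pos rfl, zero_mul, zero_add,
    Finset.mul_sum]
  refine Finset.sum_congr rfl fun j hj => ?_
  rw [if_neg (Finset.ne_of_mem_erase hj).symm]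
  ring

variable {κ}

/-- The Markov property at `s = 0`, after taking expectations. -/
theorem IsUrnSystem.integral_eq {Ω : Type*} [MeasurableSpace Ω] {P : Measure Ω}
    [IsProbabilityMeasure P] {X : ℝ≥0 → Ω → Config N} (hX : κ.IsUrnSystem N P X)
    (f : Config N →ᵇ ℝ) (t : ℝ≥0) :
    ∫ ω, f (X t ω) ∂P = ∫ ω, κ.semigroup N t f (X 0 ω) ∂P := by
  have hm : (⨆ r ∈ Set.Iic (0 : ℝ≥0), MeasurableSpace.comap (X r) inferInstance) ≤
      (inferInstance : MeasurableSpace Ω) :=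
    iSup₂_le fun r _ => (hX.measurable r).comap_le
  have h := integral_congr_ae (hX.markov 0 t f)
  rw [integral_condExp hm, zero_add] at h
  exact h

/-- The marginal distributions of an urn system solve the forward equation. -/
theorem IsUrnSystem.isForwardSolution {Ω : Type*} [MeasurableSpace Ω] {P : Measure Ω}
    [IsProbabilityMeasure P] {X : ℝ≥0 → Ω → Config N} (hX : κ.IsUrnSystem N P X) :
    IsForwardSolution (κ.jumpRate N) (κ.jumpMap N) fun s => P.map (X s.toNNReal) where
  isProbabilityMeasure s := Measure.isProbabilityMeasure_map (hX.measurable _).aemeasurable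
  hasDeriv f s hs := by
    have hmap : ∀ (g : Config N →ᵇ ℝ) (t : ℝ≥0), ∫ x, g x ∂P.map (X t) = ∫ ω, g (X t ω) ∂P :=
      fun g t => integral_map (hX.measurable t).aemeasurable
        g.continuous.measurable.aestronglyMeasurable
    have hint : ∀ g : Config N →ᵇ ℝ, Integrable (fun ω => g (X 0 ω)) P := fun g =>
      Integrable.of_bound (g.continuous.measurable.comp (hX.measurable 0)).aestronglyMeasurable
        ‖g‖ (Eventually.of_forall fun ω => g.norm_coe_le_norm _)
    -- The initial law as a bounded functional, through which the norm derivative of `exp(r L) f`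
    -- passes. The form `exp(s L) (L f)` of that derivative is the integral of `L f` against the law
    -- at time `s`.
    let ℓ : (Config N →ᵇ ℝ) →L[ℝ] ℝ := LinearMap.mkContinuous
      { toFun := fun g => ∫ ω, g (X 0 ω) ∂P
        map_add' := fun g h => integral_add (hint g) (hint h)
        map_smul' := fun r g => integral_const_mul r _ } 1 (fun g => by
          rw [one_mul]
          refine (norm_integral_le_of_norm_le_const (C := ‖g‖)
            (Eventually.of_forall fun ω => g.norm_coe_le_norm _)).trans ?_
          simp)
    have hℓ : ∀ (g : Config N →ᵇ ℝ) (r : ℝ), 0 ≤ r →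
        ∫ x, g x ∂P.map (X r.toNNReal) = ℓ (expOp (r • κ.generator N) g) := by
      intro g r hr
      rw [hmap, hX.integral_eq, semigroup, Real.coe_toNNReal r hr]
      rfl
    have hd : HasDerivAt (fun r : ℝ => ℓ (expOp (r • κ.generator N) f))
        (ℓ (expOp (s • κ.generator N) (κ.generator N f))) s :=
      ℓ.hasFDerivAt.comp_hasDerivAt s (hasDerivAt_expOp_smul_apply' (κ.generator N) f s)
    simp only [← generator_eq_jumpGen]
    rw [hℓ _ s hs]
    exact hd.hasDerivWithinAt.congr (fun r hr => hℓ f r hr) (hℓ f s hs)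

variable (κ) in
/-- `K ≥ 1` is a common upper bound of all coefficients. -/
structure IsBound (K : ℝ) : Prop where
  one_le : 1 ≤ K
  b_le : ∀ u, (κ.b u : ℝ) ≤ K
  c_le : ∀ u, (κ.c u : ℝ) ≤ K
  lam_le : ∀ p, (κ.lam p : ℝ) ≤ K
  a₁_le : ∀ p, (κ.a₁ p : ℝ) ≤ K
  a₂_le : ∀ p, (κ.a₂ p : ℝ) ≤ K
  a₃_le : ∀ p, (κ.a₃ p : ℝ) ≤ K
  a₄_le : ∀ p, (κ.a₄ p : ℝ) ≤ K

variable (κ) in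
theorem exists_isBound : ∃ K, κ.IsBound K := by
  have h : ∀ {Y : Type} [TopologicalSpace Y] [CompactSpace Y] (f : C(Y, ℝ≥0)),
      ∃ K : ℝ, ∀ y, (f y : ℝ) ≤ K := fun f => by
    obtain ⟨K, hK⟩ := isCompact_univ.exists_bound_of_continuousOn
      (f := fun y => (f y : ℝ)) (by fun_prop)
    exact ⟨K, fun y => (le_abs_self _).trans (hK y trivial)⟩
  obtain ⟨K₁, h₁⟩ := h κ.b
  obtain ⟨K₂, h₂⟩ := h κ.c
  obtain ⟨K₃, h₃⟩ := h κ.lam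
  obtain ⟨K₄, h₄⟩ := h κ.a₁
  obtain ⟨K₅, h₅⟩ := h κ.a₂
  obtain ⟨K₆, h₆⟩ := h κ.a₃
  obtain ⟨K₇, h₇⟩ := h κ.a₄
  have hle := fun y hy => Finset.le_max' {1, K₁, K₂, K₃, K₄, K₅, K₆, K₇} y hy
  refine ⟨Finset.max' {1, K₁, K₂, K₃, K₄, K₅, K₆, K₇} ⟨1, by simp⟩, hle 1 (by simp),
    fun u => (h₁ u).trans (hle _ (by simp)), fun u => (h₂ u).trans (hle _ (by simp)),
    fun u => (h₃ u).trans (hle _ (by simp)), fun u => (h₄ u).trans (hle _ (by simp)),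
    fun u => (h₅ u).trans (hle _ (by simp)), fun u => (h₆ u).trans (hle _ (by simp)),
    fun u => (h₇ u).trans (hle _ (by simp))⟩

variable (κ)

theorem sum_selfJump_sub (F : Fin N → ℝ≥0 → ℝ) (i : Fin N) (x : Config N) :
    ∑ k, F k (κ.selfJump i x k) - ∑ k, F k (x k) = F i (κ.c (site i) * x i) - F i (x i) := by
  rw [← Finset.sum_sub_distrib, Fintype.sum_eq_single i]
  · simp [selfJump]
  · intro k hk
    simp [selfJump, hk]

theorem sum_pairJump_sub (F : Fin N → ℝ≥0 → ℝ) {i j : Fin N} (hij : i ≠ j) (x : Config N) :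
    ∑ k, F k (κ.pairJump i j x k) - ∑ k, F k (x k) =
      (F i (κ.a₁ (site i, site j) * x i + κ.a₂ (site i, site j) * x j) - F i (x i)) +
      (F j (κ.a₃ (site i, site j) * x i + κ.a₄ (site i, site j) * x j) - F j (x j)) := by
  rw [← Finset.sum_sub_distrib, Fintype.sum_eq_add i j hij]
  · simp [pairJump, hij.symm]
  · rintro k ⟨hi, hj⟩
    simp [pairJump, hi, hj]

variable {κ}

/-- Double sums against the rates of the pair jumps, whose summands are controlled by the two
coordinates involved. -/
theorem IsBound.sum_pair_le {K : ℝ} (hK : κ.IsBound K) {D : Fin N → Fin N → ℝ} {y : Fin N → ℝ}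
    (hy : ∀ i, 0 ≤ y i) {R : ℝ} (hR : 0 ≤ R) (hD : ∀ i j, i ≠ j → D i j ≤ R * (y i + y j)) :
    ∑ i : Fin N, ∑ j : Fin N, (if i = j then 0 else (κ.lam (site i, site j) : ℝ) / N) * D i j ≤
      2 * K * R * ∑ i, y i := by
  have hK0 : 0 ≤ K := zero_le_one.trans hK.one_le
  have hterm : ∀ i j : Fin N,
      (if i = j then 0 else (κ.lam (site i, site j) : ℝ) / N) * D i j ≤
        K / N * (R * (y i + y j)) := by
    intro i j
    have h0 : 0 ≤ R * (y i + y j) := mul_nonneg hR (add_nonneg (hy i) (hy j))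
    split_ifs with hij
    · rw [zero_mul]
      positivity
    · exact (mul_le_mul_of_nonneg_left (hD i j hij) (by positivity)).trans
        (mul_le_mul_of_nonneg_right (by gcongr; exact hK.lam_le _) h0)
  refine (Finset.sum_le_sum fun i _ => Finset.sum_le_sum fun j _ => hterm i j).trans ?_
  rcases Nat.eq_zero_or_pos N with rfl | hN
  · simp
  have hN0 : (N : ℝ) ≠ 0 := by positivity
  -- Each of the two double sums equals `N * ∑ y i`, which cancels the `1 / N` in the rates and
  -- leaves the factor `2`.
  simp only [← Finset.mul_sum, Finset.sum_add_distrib, Finset.sum_const, Finset.card_univ,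
    Fintype.card_fin, nsmul_eq_mul]
  field_simp
  linarith

/-- The mean square of a configuration. -/
def meanSq (x : Config N) : ℝ := (1 / (N : ℝ)) * ∑ i, (x i : ℝ) ^ 2

theorem meanSq_nonneg (x : Config N) : 0 ≤ meanSq x := by
  unfold meanSq
  positivity

theorem continuous_meanSq : Continuous (meanSq (N := N)) := by
  unfold meanSq
  fun_prop

theorem sq_coord_le (x : Config N) (i : Fin N) : (x i : ℝ) ^ 2 ≤ N * meanSq x := by
  have hN : (N : ℝ) ≠ 0 := by exact_mod_cast i.pos.ne'
  have h := Finset.single_le_sum (f := fun k => (x k : ℝ) ^ 2) (fun k _ => sq_nonneg _)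
    (Finset.mem_univ i)
  unfold meanSq
  rw [← mul_assoc, mul_one_div_cancel hN, one_mul]
  exact h

theorem mean_sq_le (x : Config N) : ((1 / (N : ℝ)) * ∑ i, (x i : ℝ)) ^ 2 ≤ meanSq x := by
  rcases Nat.eq_zero_or_pos N with rfl | hN
  · simp [meanSq]
  have h := sq_sum_le_card_mul_sum_sq (s := Finset.univ) (f := fun i => (x i : ℝ))
  rw [Finset.card_univ, Fintype.card_fin] at h
  have hN0 : (0 : ℝ) < N := by exact_mod_cast hN
  unfold meanSq
  rw [mul_pow, ← sub_nonneg]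
  have : 1 / (N : ℝ) * ∑ i, (x i : ℝ) ^ 2 - (1 / N) ^ 2 * (∑ i, (x i : ℝ)) ^ 2 =
      (1 / N) ^ 2 * (N * ∑ i, (x i : ℝ) ^ 2 - (∑ i, (x i : ℝ)) ^ 2) := by
    field_simp
  rw [this]
  exact mul_nonneg (by positivity) (sub_nonneg.2 h)

theorem mul_add_mul_sq_le {K a b x y : ℝ} (ha : |a| ≤ K) (hb : |b| ≤ K) :
    (a * x + b * y) ^ 2 ≤ 2 * K ^ 2 * (x ^ 2 + y ^ 2) := by
  have ha2 : a ^ 2 ≤ K ^ 2 := sq_le_sq' (abs_le.1 ha).1 (abs_le.1 ha).2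
  have hb2 : b ^ 2 ≤ K ^ 2 := sq_le_sq' (abs_le.1 hb).1 (abs_le.1 hb).2
  nlinarith [sq_nonneg (a * x - b * y), mul_le_mul_of_nonneg_right ha2 (sq_nonneg x),
    mul_le_mul_of_nonneg_right hb2 (sq_nonneg y)]

theorem abs_coe_le {K : ℝ} {a : ℝ≥0} (h : (a : ℝ) ≤ K) : |(a : ℝ)| ≤ K := by
  rwa [abs_of_nonneg a.coe_nonneg]

theorem abs_coe_sub_one_le {K : ℝ} {a : ℝ≥0} (hK : 1 ≤ K) (h : (a : ℝ) ≤ K) :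
    |(a : ℝ) - 1| ≤ K := by
  rw [abs_le]
  constructor <;> linarith [a.coe_nonneg]

/-- Self jumps contribute `K * K ^ 2`. A pair jump creates two coordinates with squares at most `2
K² (x i ² + x j ²)`, which gives `2 K * 4 K ^ 2`. The sum `9 K ^ 3` does not depend on `N`. -/
theorem IsBound.jumpGen_meanSq_le {K : ℝ} (hK : κ.IsBound K) (x : Config N) :
    jumpGen (κ.jumpRate N) (κ.jumpMap N) (fun y => 1 + meanSq y) x ≤
      9 * K ^ 3 * (1 + meanSq x) := by
  have hK0 : 0 ≤ K := zero_le_one.trans hK.one_le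
  rw [jumpGen_urn]
  have hself : ∑ i : Fin N, (κ.b (site i) : ℝ) *
      ((1 + meanSq (κ.selfJump i x)) - (1 + meanSq x)) ≤ K ^ 3 * meanSq x := by
    have hsum : K ^ 3 * meanSq x = ∑ i, K ^ 3 * (1 / N * (x i : ℝ) ^ 2) := by
      rw [meanSq, Finset.mul_sum, Finset.mul_sum]
    rw [hsum]
    refine Finset.sum_le_sum fun i _ => ?_
    unfold meanSq
    have h := κ.sum_selfJump_sub (fun _ r => (r : ℝ) ^ 2) i x
    rw [add_sub_add_left_eq_sub, ← mul_sub, h]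
    push_cast
    have hc : (κ.c (site i) : ℝ) ^ 2 ≤ K ^ 2 :=
      pow_le_pow_left₀ (NNReal.coe_nonneg _) (hK.c_le _) 2
    have h1 : ((κ.c (site i) : ℝ) * x i) ^ 2 - (x i : ℝ) ^ 2 ≤ K ^ 2 * (x i : ℝ) ^ 2 := by
      nlinarith [mul_le_mul_of_nonneg_right hc (sq_nonneg (x i : ℝ)), sq_nonneg (x i : ℝ)]
    calc (κ.b (site i) : ℝ) * (1 / N * (((κ.c (site i) : ℝ) * x i) ^ 2 - (x i : ℝ) ^ 2))
        ≤ (κ.b (site i) : ℝ) * (1 / N * (K ^ 2 * (x i : ℝ) ^ 2)) :=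
          mul_le_mul_of_nonneg_left (mul_le_mul_of_nonneg_left h1 (by positivity))
            (NNReal.coe_nonneg _)
      _ ≤ K * (1 / N * (K ^ 2 * (x i : ℝ) ^ 2)) := by gcongr; exact hK.b_le _
      _ = K ^ 3 * (1 / N * (x i : ℝ) ^ 2) := by ring
  have hpair := hK.sum_pair_le
    (D := fun i j => (1 + meanSq (κ.pairJump i j x)) - (1 + meanSq x))
    (y := fun i => (x i : ℝ) ^ 2) (fun i => sq_nonneg _) (R := 1 / N * (4 * K ^ 2)) (by positivity)
    (fun i j hij => by
      have h := κ.sum_pairJump_sub (fun _ r => (r : ℝ) ^ 2) hij x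
      simp only [meanSq]
      rw [add_sub_add_left_eq_sub, ← mul_sub, h, mul_assoc]
      push_cast
      refine mul_le_mul_of_nonneg_left ?_ (by positivity)
      have h1 := mul_add_mul_sq_le (x := (x i : ℝ)) (y := (x j : ℝ))
        (abs_coe_le (hK.a₁_le (site i, site j))) (abs_coe_le (hK.a₂_le (site i, site j)))
      have h2 := mul_add_mul_sq_le (x := (x i : ℝ)) (y := (x j : ℝ))
        (abs_coe_le (hK.a₃_le (site i, site j))) (abs_coe_le (hK.a₄_le (site i, site j)))
      nlinarith [sq_nonneg (x i : ℝ), sq_nonneg (x j : ℝ)])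
  have h3 : 2 * K * (1 / N * (4 * K ^ 2)) * ∑ i, (x i : ℝ) ^ 2 = 8 * K ^ 3 * meanSq x := by
    unfold meanSq
    ring
  rw [h3] at hpair
  have h4 : 0 ≤ K ^ 3 := by positivity
  nlinarith

theorem IsBound.jumpMap_sq_le {K : ℝ} (hK : κ.IsBound K) (e : Fin N ⊕ (Fin N × Fin N))
    (x : Config N) (k : Fin N) :
    (κ.jumpMap N e x k : ℝ) ^ 2 ≤ 5 * K ^ 2 * (N * meanSq x) := by
  have h1 : 1 ≤ K ^ 2 := one_le_pow₀ hK.one_le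
  have hS : ∀ i, (x i : ℝ) ^ 2 ≤ N * meanSq x := sq_coord_le x
  have hS0 : 0 ≤ (N : ℝ) * meanSq x := mul_nonneg (Nat.cast_nonneg _) (meanSq_nonneg x)
  have hk : (x k : ℝ) ^ 2 ≤ 5 * K ^ 2 * (N * meanSq x) := by nlinarith [hS k]
  have hlin : ∀ (a b : ℝ≥0) (i j : Fin N), (a : ℝ) ≤ K → (b : ℝ) ≤ K →
      ((a : ℝ) * x i + b * x j) ^ 2 ≤ 5 * K ^ 2 * (N * meanSq x) := by
    intro a b i j ha hb
    have h := mul_add_mul_sq_le (x := (x i : ℝ)) (y := (x j : ℝ)) (abs_coe_le ha) (abs_coe_le hb)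
    nlinarith [hS i, hS j]
  rcases e with i | ⟨i, j⟩
  · simp only [jumpMap, selfJump, ContinuousMap.coe_mk]
    split_ifs with h
    · simpa using hlin (κ.c (site i)) 0 i i (hK.c_le _) (zero_le_one.trans hK.one_le)
    · exact hk
  · simp only [jumpMap, pairJump, ContinuousMap.coe_mk]
    split_ifs with h h'
    · simpa using hlin _ _ i j (hK.a₁_le (site i, site j)) (hK.a₂_le (site i, site j))
    · simpa using hlin _ _ i j (hK.a₃_le (site i, site j)) (hK.a₄_le (site i, site j))
    · exact hk

/-- The jump factor may grow with `N`, since it only serves domination at fixed `N`; the moment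
bounds involve the growth rate alone. The summand `1` lets the function dominate constants and
linear functions as well. -/
theorem IsBound.isLyapunov {K : ℝ} (hK : κ.IsBound K) (N : ℕ) :
    IsLyapunov (κ.jumpRate N) (κ.jumpMap N) (fun x => 1 + meanSq x) (9 * K ^ 3)
      (1 + 5 * K ^ 2 * N) where
  continuous := continuous_const.add continuous_meanSq
  nonneg x := add_nonneg zero_le_one (meanSq_nonneg x)
  rate_nonneg e := by
    rcases e with i | p
    · exact NNReal.coe_nonneg _
    · simp only [jumpRate]
      split_ifs <;> positivity
  growth_nonneg := by
    have := zero_le_one.trans hK.one_le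
    positivity
  factor_nonneg := by positivity
  jumpGen_le := hK.jumpGen_meanSq_le
  comp_le e x := by
    have h : meanSq (κ.jumpMap N e x) ≤ 5 * K ^ 2 * (N * meanSq x) := by
      rcases Nat.eq_zero_or_pos N with rfl | hN
      · simp [meanSq]
      have h1 := Finset.sum_le_sum (s := Finset.univ) fun k _ => hK.jumpMap_sq_le e x k
      rw [Finset.sum_const, Finset.card_univ, Fintype.card_fin, nsmul_eq_mul] at h1
      have hN0 : (0 : ℝ) < N := by exact_mod_cast hN
      calc meanSq (κ.jumpMap N e x)
          ≤ 1 / (N : ℝ) * (N * (5 * K ^ 2 * (N * meanSq x))) :=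
            mul_le_mul_of_nonneg_left h1 (by positivity)
        _ = 5 * K ^ 2 * (N * meanSq x) := by field_simp
    have h2 := meanSq_nonneg x
    have h3 : 0 ≤ 5 * K ^ 2 * (N : ℝ) := by positivity
    show 1 + meanSq (κ.jumpMap N e x) ≤ (1 + 5 * K ^ 2 * N) * (1 + meanSq x)
    nlinarith

end UrnCoefficients

/-! ### Drift and fluctuations of the empirical measure. -/

namespace UrnCoefficients

variable (κ : UrnCoefficients) {N : ℕ}

/-- The integrand of the interaction part of `P₁ g`. -/
def interaction (g : C(I, ℝ)) (u v : I) : ℝ :=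
  κ.lossKernel (u, v) * g u +
    ((κ.lam (u, v) : ℝ) * κ.a₃ (u, v) + (κ.lam (v, u) : ℝ) * κ.a₂ (v, u)) * g v

theorem opP₁_eq_interaction (g : C(I, ℝ)) (u : I) :
    κ.opP₁ g u = (κ.b u : ℝ) * ((κ.c u : ℝ) - 1) * g u + ∫ v : I, κ.interaction g u v := by
  have hi : ∀ {k : I → ℝ}, Continuous k → Integrable k := fun hk =>
    hk.integrable_of_hasCompactSupport (HasCompactSupport.of_compactSpace _)
  unfold interaction
  rw [integral_add (hi (by fun_prop)) (hi (by fun_prop)), integral_mul_const]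
  simp only [opP₁, rate, add_apply, ContinuousMap.add_apply, ContinuousLinearMap.mul_apply',
    ContinuousMap.mul_apply, integralOp_apply, ContinuousMap.coe_mk, ContinuousMap.one_apply,
    mul_one, Prod.swap_prod_mk]
  ring

theorem empirical_selfJump_sub (g : C(I, ℝ)) (i : Fin N) (x : Config N) :
    empirical (κ.selfJump i x) g - empirical x g =
      1 / (N : ℝ) * (((κ.c (site i) : ℝ) - 1) * x i * g (site i)) := by
  have h := κ.sum_selfJump_sub (fun k r => (r : ℝ) * g (site k)) i x
  unfold empirical
  rw [← mul_sub, h]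
  push_cast
  ring

theorem empirical_pairJump_sub (g : C(I, ℝ)) {i j : Fin N} (hij : i ≠ j) (x : Config N) :
    empirical (κ.pairJump i j x) g - empirical x g =
      1 / (N : ℝ) * ((((κ.a₁ (site i, site j) : ℝ) - 1) * x i + κ.a₂ (site i, site j) * x j) *
          g (site i) +
        ((κ.a₃ (site i, site j) : ℝ) * x i + ((κ.a₄ (site i, site j) : ℝ) - 1) * x j) *
          g (site j)) := by
  have h := κ.sum_pairJump_sub (fun k r => (r : ℝ) * g (site k)) hij x
  unfold empirical
  rw [← mul_sub, h]
  push_cast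
  ring

/-- The jumps are linear in `x`, so collecting the coefficient of each `x i` gives `P₁ g` at its
site, with the integral replaced by an average over the other sites. -/
theorem jumpGen_empirical (g : C(I, ℝ)) (x : Config N) :
    jumpGen (κ.jumpRate N) (κ.jumpMap N) (fun y => empirical y g) x =
      1 / (N : ℝ) * ∑ i, (x i : ℝ) * ((κ.b (site i) : ℝ) * ((κ.c (site i) : ℝ) - 1) * g (site i) +
        1 / (N : ℝ) * ∑ j, if i = j then 0 else κ.interaction g (site i) (site j)) := by
  -- `U` collects what the first urn of a pair contributes and `W` what the second does; exchanging
  -- the roles of `i` and `j` in `W` makes both multiply `x i`.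
  set U : Fin N → Fin N → ℝ := fun i j => (if i = j then 0 else
    (κ.lam (site i, site j) : ℝ) * (((κ.a₁ (site i, site j) : ℝ) - 1) * g (site i) +
      κ.a₃ (site i, site j) * g (site j))) with hU
  set W : Fin N → Fin N → ℝ := fun i j => (if i = j then 0 else
    (κ.lam (site i, site j) : ℝ) * (κ.a₂ (site i, site j) * g (site i) +
      ((κ.a₄ (site i, site j) : ℝ) - 1) * g (site j))) with hW
  have hpair : ∀ i j : Fin N, (if i = j then 0 else (κ.lam (site i, site j) : ℝ) / N) *
      (empirical (κ.pairJump i j x) g - empirical x g) =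
        1 / (N : ℝ) * (1 / (N : ℝ) * (x i * U i j)) +
          1 / (N : ℝ) * (1 / (N : ℝ) * (x j * W i j)) := by
    intro i j
    simp only [hU, hW]
    split_ifs with hij
    · simp
    · rw [κ.empirical_pairJump_sub g hij]
      ring
  have hUW : ∀ i j : Fin N, U i j + W j i =
      if i = j then 0 else κ.interaction g (site i) (site j) := by
    intro i j
    simp only [hU, hW, interaction, lossKernel, ContinuousMap.coe_mk, Prod.swap_prod_mk,
      eq_comm (a := j)]
    split_ifs
    · simp
    · ring
  rw [jumpGen_urn]
  simp only [empirical_selfJump_sub, hpair, ← hUW, Finset.sum_add_distrib, mul_add, Finset.mul_sum]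
  rw [Finset.sum_comm (f := fun i j => 1 / (N : ℝ) * (1 / (N : ℝ) * (x j * W i j)))]
  congr 1
  · refine Finset.sum_congr rfl fun i _ => ?_
    ring
  · congr 1 <;>
    · refine Finset.sum_congr rfl fun i _ => Finset.sum_congr rfl fun j _ => ?_
      ring

/-- The drift of the empirical measure is close to the one given by `P₁`. -/
theorem abs_jumpGen_empirical_sub_le (g : C(I, ℝ)) {B' ε : ℝ}
    (hB' : ∀ u v, |κ.interaction g u v| ≤ B')
    (hε : ∀ u, |(1 / (N : ℝ)) * ∑ j : Fin N, κ.interaction g u (site j) -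
      ∫ v : I, κ.interaction g u v| ≤ ε) (x : Config N) :
    |jumpGen (κ.jumpRate N) (κ.jumpMap N) (fun y => empirical y g) x - empirical x (κ.opP₁ g)| ≤
      (ε + B' / N) * (1 / (N : ℝ) * ∑ i, (x i : ℝ)) := by
  rw [jumpGen_empirical, empirical, ← mul_sub, ← Finset.sum_sub_distrib, abs_mul,
    abs_of_nonneg (by positivity : 0 ≤ 1 / (N : ℝ)), mul_left_comm]
  refine mul_le_mul_of_nonneg_left ?_ (by positivity)
  refine (Finset.abs_sum_le_sum_abs _ _).trans ?_
  rw [Finset.mul_sum]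
  refine Finset.sum_le_sum fun i _ => ?_
  rw [opP₁_eq_interaction, ← mul_sub, add_sub_add_left_eq_sub, abs_mul,
    abs_of_nonneg (NNReal.coe_nonneg (x i)), mul_comm]
  refine mul_le_mul_of_nonneg_right ?_ (NNReal.coe_nonneg _)
  -- Restoring the diagonal term costs at most `B' / N`.
  have hsum : ∑ j, (if i = j then 0 else κ.interaction g (site i) (site j)) =
      ∑ j : Fin N, κ.interaction g (site i) (site j) - κ.interaction g (site i) (site i) := by
    rw [eq_sub_iff_add_eq, ← Finset.add_sum_erase _ _ (Finset.mem_univ i), if_pos rfl, zero_add,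
      ← Finset.add_sum_erase (a := i) _ (fun j => κ.interaction g (site i) (site j))
        (Finset.mem_univ i), add_comm]
    congr 1
    exact Finset.sum_congr rfl fun j hj => if_neg (Finset.ne_of_mem_erase hj).symm
  rw [hsum, mul_sub, sub_right_comm]
  refine (abs_sub _ _).trans (add_le_add (hε _) ?_)
  rw [abs_mul, abs_of_nonneg (by positivity : 0 ≤ 1 / (N : ℝ)), one_div_mul_eq_div]
  gcongr
  exact hB' _ _

variable {κ}

/-- A jump changes the empirical measure by `1/N` times the coordinates involved. The square gains
`1/N²`, of which the sum over urns consumes one factor `1/N`. The constant is `1` from self jumps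
plus `2 * 8` from pair jumps. -/
theorem IsBound.carreDuChamp_empirical_le {K : ℝ} (hK : κ.IsBound K) {g : C(I, ℝ)} {B : ℝ}
    (hB : ‖g‖ ≤ B) (x : Config N) :
    ∑ e, κ.jumpRate N e * (empirical (κ.jumpMap N e x) g - empirical x g) ^ 2 ≤
      17 * K ^ 3 * B ^ 2 / N * meanSq x := by
  have hK0 : 0 ≤ K := zero_le_one.trans hK.one_le
  have hB0 : 0 ≤ B := (norm_nonneg g).trans hB
  have hg : ∀ u, |g u| ≤ B := fun u => (g.norm_coe_le_norm u).trans hB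
  simp only [Fintype.sum_sum_type, Fintype.sum_prod_type, jumpRate, jumpMap]
  have hself : ∑ i : Fin N, (κ.b (site i) : ℝ) *
      (empirical (κ.selfJump i x) g - empirical x g) ^ 2 ≤ K ^ 3 * B ^ 2 / N * meanSq x := by
    have hsum : K ^ 3 * B ^ 2 / N * meanSq x =
        ∑ i, K * ((1 / N) ^ 2 * ((K * (x i : ℝ) * B) ^ 2)) := by
      rw [meanSq, Finset.mul_sum, Finset.mul_sum]
      refine Finset.sum_congr rfl fun i _ => ?_
      ring
    rw [hsum]
    refine Finset.sum_le_sum fun i _ => ?_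
    refine mul_le_mul (hK.b_le _) ?_ (sq_nonneg _) hK0
    rw [κ.empirical_selfJump_sub, mul_pow]
    refine mul_le_mul_of_nonneg_left ?_ (by positivity)
    rw [← sq_abs, abs_mul, abs_mul, abs_of_nonneg (NNReal.coe_nonneg (x i))]
    refine pow_le_pow_left₀ (by positivity) ?_ 2
    gcongr
    · exact abs_coe_sub_one_le hK.one_le (hK.c_le _)
    · exact hg _
  have hpair := hK.sum_pair_le
    (D := fun i j => (empirical (κ.pairJump i j x) g - empirical x g) ^ 2)
    (y := fun i => (x i : ℝ) ^ 2) (fun i => sq_nonneg _)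
    (R := (1 / N) ^ 2 * (8 * K ^ 2 * B ^ 2)) (by positivity)
    (fun i j hij => by
      rw [κ.empirical_pairJump_sub g hij, mul_pow, mul_assoc]
      refine mul_le_mul_of_nonneg_left ?_ (by positivity)
      have h0 := mul_add_mul_sq_le
        (x := ((κ.a₁ (site i, site j) : ℝ) - 1) * x i + κ.a₂ (site i, site j) * x j)
        (y := (κ.a₃ (site i, site j) : ℝ) * x i + ((κ.a₄ (site i, site j) : ℝ) - 1) * x j)
        (hg (site i)) (hg (site j))
      have h1 := mul_add_mul_sq_le (x := (x i : ℝ)) (y := (x j : ℝ))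
        (abs_coe_sub_one_le hK.one_le (hK.a₁_le (site i, site j)))
        (abs_coe_le (hK.a₂_le (site i, site j)))
      have h2 := mul_add_mul_sq_le (x := (x i : ℝ)) (y := (x j : ℝ))
        (abs_coe_le (hK.a₃_le (site i, site j)))
        (abs_coe_sub_one_le hK.one_le (hK.a₄_le (site i, site j)))
      have h3 := mul_le_mul_of_nonneg_left (add_le_add h1 h2)
        (by positivity : 0 ≤ 2 * B ^ 2)
      calc _ = (g (site i) * (((κ.a₁ (site i, site j) : ℝ) - 1) * x i +
              κ.a₂ (site i, site j) * x j) + g (site j) * ((κ.a₃ (site i, site j) : ℝ) * x i +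
              ((κ.a₄ (site i, site j) : ℝ) - 1) * x j)) ^ 2 := by ring
        _ ≤ _ := h0.trans h3
        _ = _ := by ring)
  have h3 : 2 * K * ((1 / N) ^ 2 * (8 * K ^ 2 * B ^ 2)) * ∑ i, (x i : ℝ) ^ 2 =
      16 * K ^ 3 * B ^ 2 / N * meanSq x := by
    unfold meanSq
    ring
  rw [h3] at hpair
  refine (add_le_add hself hpair).trans (le_of_eq ?_)
  ring

theorem abs_empirical_le {g : C(I, ℝ)} {B : ℝ} (hB : ‖g‖ ≤ B) (x : Config N) :
    |empirical x g| ≤ B * (1 / (N : ℝ) * ∑ i, (x i : ℝ)) := by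
  rw [empirical, abs_mul, abs_of_nonneg (by positivity : 0 ≤ 1 / (N : ℝ)), mul_left_comm]
  refine mul_le_mul_of_nonneg_left ?_ (by positivity)
  refine (Finset.abs_sum_le_sum_abs _ _).trans ?_
  rw [Finset.mul_sum]
  refine Finset.sum_le_sum fun i _ => ?_
  rw [abs_mul, abs_of_nonneg (NNReal.coe_nonneg (x i)), mul_comm]
  exact mul_le_mul_of_nonneg_right ((g.norm_coe_le_norm _).trans hB) (NNReal.coe_nonneg _)

theorem continuous_empirical (g : C(I, ℝ)) : Continuous fun x : Config N => empirical x g := by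
  unfold empirical
  fun_prop

/-- The growth of `(μ(g) - a)²`, compensated by the motion of `g` along `-P₁ g`. -/
theorem IsBound.jumpGen_sq_empirical_le {K : ℝ} (hK : κ.IsBound K) {g : C(I, ℝ)} {B B' ε : ℝ}
    (hB : ‖g‖ ≤ B) (hB' : ∀ u v, |κ.interaction g u v| ≤ B') (hε0 : 0 ≤ ε)
    (hε : ∀ u, |(1 / (N : ℝ)) * ∑ j : Fin N, κ.interaction g u (site j) -
      ∫ v : I, κ.interaction g u v| ≤ ε) (a : ℝ) (x : Config N) :
    jumpGen (κ.jumpRate N) (κ.jumpMap N) (fun y => (empirical y g - a) ^ 2) x -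
        2 * (empirical x g - a) * empirical x (κ.opP₁ g) ≤
      (17 * K ^ 3 * B ^ 2 / N + 2 * (B + |a|) * (ε + B' / N)) * (1 + meanSq x) := by
  have hB0 : 0 ≤ B := (norm_nonneg g).trans hB
  have hB'0 : 0 ≤ B' := (abs_nonneg _).trans (hB' 0 0)
  have hK0 : 0 ≤ K := zero_le_one.trans hK.one_le
  have hd := κ.abs_jumpGen_empirical_sub_le g hB' hε x
  have hΓ := hK.carreDuChamp_empirical_le hB x
  have he := abs_empirical_le hB x
  have hm2 := mean_sq_le x
  have hm0 : 0 ≤ 1 / (N : ℝ) * ∑ i, (x i : ℝ) := by positivity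
  set m := 1 / (N : ℝ) * ∑ i, (x i : ℝ) with hm
  set η := ε + B' / N with hη
  have hη0 : 0 ≤ η := by positivity
  rw [jumpGen_sq]
  have hconst : jumpGen (κ.jumpRate N) (κ.jumpMap N) (fun y => empirical y g - a) x =
      jumpGen (κ.jumpRate N) (κ.jumpMap N) (fun y => empirical y g) x := by
    simp only [jumpGen, sub_sub_sub_cancel_right]
  simp only [hconst, sub_sub_sub_cancel_right]
  -- After compensation only `2 (μ(g) - a) D` and the carré du champ survive.
  set D := jumpGen (κ.jumpRate N) (κ.jumpMap N) (fun y => empirical y g) x -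
    empirical x (κ.opP₁ g) with hD
  have hq : |empirical x g - a| ≤ B * m + |a| := (abs_sub _ _).trans (by gcongr)
  have h1 : (empirical x g - a) * D ≤ (B * m + |a|) * (η * m) :=
    (le_abs_self _).trans (by rw [abs_mul]; gcongr)
  have hm1 : m ≤ 1 + meanSq x := by nlinarith [sq_nonneg (m - 1)]
  have hm3 : m ^ 2 ≤ 1 + meanSq x := by linarith
  have h2 : (B * m + |a|) * (η * m) ≤ (B + |a|) * η * (1 + meanSq x) := by
    have e1 := mul_le_mul_of_nonneg_left hm3 (mul_nonneg hB0 hη0)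
    have e2 := mul_le_mul_of_nonneg_left hm1 (mul_nonneg (abs_nonneg a) hη0)
    nlinarith
  have h3 : 0 ≤ 17 * K ^ 3 * B ^ 2 / N := by positivity
  simp only [hD] at h1
  nlinarith

end UrnCoefficients

/-! ### Moments of the initial configuration. -/

namespace BernoulliInitial

variable {Ω : Type*} [MeasurableSpace Ω] {φ : C(I, ℝ)} {N : ℕ} {P : Measure Ω}
  [IsProbabilityMeasure P] {X₀ : Ω → Config N}

/-- The two prescribed probabilities belong to disjoint events and add up to one, so nothing is left
for other values. -/
theorem ae_zero_or_one (h : BernoulliInitial φ P X₀) (hm : Measurable X₀) (i : Fin N) :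
    ∀ᵐ ω ∂P, X₀ ω i = 0 ∨ X₀ ω i = 1 := by
  have hmi : Measurable fun ω => X₀ ω i := (measurable_pi_apply i).comp hm
  have h0 : MeasurableSet {ω | X₀ ω i = 0} := hmi (measurableSet_singleton 0)
  have h1 : MeasurableSet {ω | X₀ ω i = 1} := hmi (measurableSet_singleton 1)
  have hd : Disjoint {ω | X₀ ω i = 0} {ω | X₀ ω i = 1} :=
    Set.disjoint_left.2 fun ω (ha : X₀ ω i = 0) (hb : X₀ ω i = 1) =>
      zero_ne_one (ha.symm.trans hb)
  have hu : P.real ({ω | X₀ ω i = 0} ∪ {ω | X₀ ω i = 1}) = 1 := by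
    rw [measureReal_union hd h1, h.prob_zero, h.prob_one]
    ring
  have hu' : P ({ω | X₀ ω i = 0} ∪ {ω | X₀ ω i = 1}) = 1 := by
    rwa [measureReal_def, ENNReal.toReal_eq_one_iff] at hu
  exact (prob_compl_eq_zero_iff (h0.union h1)).2 hu'

theorem measurable_coord (hm : Measurable X₀) (i : Fin N) :
    Measurable fun ω => (X₀ ω i : ℝ) :=
  measurable_coe_nnreal_real.comp ((measurable_pi_apply i).comp hm)

theorem ae_mem_Icc (h : BernoulliInitial φ P X₀) (hm : Measurable X₀) (i : Fin N) :
    ∀ᵐ ω ∂P, (X₀ ω i : ℝ) ∈ Set.Icc (0 : ℝ) 1 := by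
  filter_upwards [h.ae_zero_or_one hm i] with ω hω
  rcases hω with hω | hω <;> simp [hω]

theorem memLp_coord (h : BernoulliInitial φ P X₀) (hm : Measurable X₀) (i : Fin N) :
    MemLp (fun ω => (X₀ ω i : ℝ)) 2 P := by
  refine MemLp.of_bound (measurable_coord hm i).aestronglyMeasurable 1 ?_
  filter_upwards [h.ae_mem_Icc hm i] with ω hω
  rw [Real.norm_eq_abs, abs_of_nonneg hω.1]
  exact hω.2

theorem integral_coord (h : BernoulliInitial φ P X₀) (hm : Measurable X₀) (i : Fin N) :
    ∫ ω, (X₀ ω i : ℝ) ∂P = φ (site i) := by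
  have h1 : MeasurableSet {ω | X₀ ω i = 1} :=
    ((measurable_pi_apply i).comp hm) (measurableSet_singleton 1)
  have hae : (fun ω => (X₀ ω i : ℝ)) =ᵐ[P] {ω | X₀ ω i = 1}.indicator 1 := by
    filter_upwards [h.ae_zero_or_one hm i] with ω hω
    rcases hω with hω | hω <;> simp [hω]
  rw [integral_congr_ae hae, integral_indicator_one h1, h.prob_one]

theorem variance_coord_le (h : BernoulliInitial φ P X₀) (hm : Measurable X₀) (i : Fin N) :
    Var[fun ω => (X₀ ω i : ℝ); P] ≤ 1 := by
  have h1 := variance_le_sq_of_bounded (h.ae_mem_Icc hm i) (measurable_coord hm i).aemeasurable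
  linarith

/-- The bias-variance decomposition of the initial empirical measure. -/
theorem integral_sq_empirical_sub_le (h : BernoulliInitial φ P X₀) (hm : Measurable X₀)
    {g : C(I, ℝ)} {B : ℝ} (hB : ‖g‖ ≤ B) (a : ℝ) :
    ∫ ω, (empirical (X₀ ω) g - a) ^ 2 ∂P ≤
      B ^ 2 / N + ((1 / (N : ℝ)) * ∑ i : Fin N, φ (site i) * g (site i) - a) ^ 2 := by
  set Y : Fin N → Ω → ℝ := fun i ω => g (site i) * (X₀ ω i : ℝ) with hY
  have hYL : ∀ i, MemLp (Y i) 2 P := fun i => (h.memLp_coord hm i).const_mul _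
  have hemp : (fun ω => empirical (X₀ ω) g) = fun ω => (1 / (N : ℝ)) * (∑ i, Y i) ω := by
    ext ω
    simp only [empirical, hY, Finset.sum_apply, mul_comm]
  have hSL : MemLp (∑ i, Y i) 2 P := memLp_finsetSum' _ fun i _ => hYL i
  have hL : MemLp (fun ω => empirical (X₀ ω) g) 2 P := by
    rw [hemp]
    exact hSL.const_mul _
  have hmean : ∫ ω, empirical (X₀ ω) g ∂P =
      (1 / (N : ℝ)) * ∑ i : Fin N, φ (site i) * g (site i) := by
    unfold empirical
    rw [integral_const_mul, integral_finsetSum _ fun i _ =>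
      ((h.memLp_coord hm i).integrable one_le_two).mul_const _]
    simp only [integral_mul_const, h.integral_coord hm]
  have hind : Set.Pairwise (↑(Finset.univ : Finset (Fin N)) : Set (Fin N))
      fun i j => IndepFun (Y i) (Y j) P := fun i _ j _ hij =>
    (h.indep.indepFun hij).comp (φ := fun r : ℝ≥0 => g (site i) * (r : ℝ))
      (ψ := fun r : ℝ≥0 => g (site j) * (r : ℝ)) (by fun_prop) (by fun_prop)
  have hvar : Var[fun ω => empirical (X₀ ω) g; P] ≤ B ^ 2 / N := by
    rw [hemp, variance_const_mul, IndepFun.variance_sum (fun i _ => hYL i) hind]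
    have hi : ∀ i ∈ (Finset.univ : Finset (Fin N)), Var[Y i; P] ≤ B ^ 2 := by
      intro i _
      rw [hY, variance_const_mul]
      have hg2 : g (site i) ^ 2 ≤ B ^ 2 := by
        rw [← sq_abs]
        exact pow_le_pow_left₀ (abs_nonneg _) ((g.norm_coe_le_norm _).trans hB) 2
      have := mul_le_mul hg2 (h.variance_coord_le hm i) (variance_nonneg _ _) (sq_nonneg B)
      rwa [mul_one] at this
    refine (mul_le_mul_of_nonneg_left (Finset.sum_le_sum hi) (sq_nonneg _)).trans (le_of_eq ?_)
    rw [Finset.sum_const, Finset.card_univ, Fintype.card_fin, nsmul_eq_mul]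
    rcases Nat.eq_zero_or_pos N with rfl | hN
    · simp
    · field_simp
  have hLa : MemLp (fun ω => empirical (X₀ ω) g - a) 2 P := hL.sub (memLp_const a)
  have hv := variance_eq_sub hLa
  rw [variance_sub_const hL.aestronglyMeasurable,
    integral_sub (hL.integrable one_le_two) (integrable_const a), integral_const, hmean] at hv
  simp only [probReal_univ, one_smul, Pi.pow_apply] at hv
  linarith

theorem integrable_meanSq (h : BernoulliInitial φ P X₀) (hm : Measurable X₀) :
    Integrable (fun x => 1 + UrnCoefficients.meanSq x) (P.map X₀) := by
  have hc : Continuous fun x : Config N => 1 + UrnCoefficients.meanSq x :=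
    continuous_const.add UrnCoefficients.continuous_meanSq
  rw [integrable_map_measure hc.measurable.aestronglyMeasurable hm.aemeasurable]
  refine (integrable_const (1 : ℝ)).add (Integrable.const_mul ?_ _)
  exact integrable_finsetSum _ fun i _ => (h.memLp_coord hm i).integrable_sq

theorem integral_meanSq_le (h : BernoulliInitial φ P X₀) (hm : Measurable X₀) :
    ∫ x, (1 + UrnCoefficients.meanSq x) ∂P.map X₀ ≤ 2 := by
  have hc : Continuous fun x : Config N => 1 + UrnCoefficients.meanSq x :=
    continuous_const.add UrnCoefficients.continuous_meanSq
  rw [integral_map hm.aemeasurable hc.measurable.aestronglyMeasurable]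
  have hae : ∀ᵐ ω ∂P, 1 + UrnCoefficients.meanSq (X₀ ω) ≤ 2 := by
    filter_upwards [ae_all_iff.2 fun i => h.ae_mem_Icc hm i] with ω hω
    have h1 : ∑ i, (X₀ ω i : ℝ) ^ 2 ≤ ∑ _i : Fin N, (1 : ℝ) :=
      Finset.sum_le_sum fun i _ => pow_le_one₀ (hω i).1 (hω i).2
    rw [Finset.sum_const, Finset.card_univ, Fintype.card_fin, nsmul_one] at h1
    have h2 : UrnCoefficients.meanSq (X₀ ω) ≤ 1 := by
      unfold UrnCoefficients.meanSq
      refine (mul_le_mul_of_nonneg_left h1 (by positivity)).trans ?_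
      rw [one_div]
      exact inv_mul_le_one
    linarith
  have := integral_mono_ae ((integrable_map_measure hc.measurable.aestronglyMeasurable
    hm.aemeasurable).1 (h.integrable_meanSq hm)) (integrable_const (2 : ℝ)) hae
  simpa using this

end BernoulliInitial

/-! ### The mean square estimate along the backward curve. -/

namespace UrnCoefficients

variable {κ : UrnCoefficients} {N : ℕ}

/-- The index `none` stands for the constant function `1`, so that `empirical x g - a` becomes a
linear combination of the functions indexed by `Option (Fin N)`. -/
theorem abs_coord_mul_coord_le (x : Config N) (k l : Option (Fin N)) :
    |(k.elim 1 fun i => (x i : ℝ)) * (l.elim 1 fun i => (x i : ℝ))| ≤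
      (N + 1 : ℝ) * (1 + meanSq x) := by
  have h : ∀ k : Option (Fin N), (k.elim 1 fun i => (x i : ℝ)) ^ 2 ≤
      (N + 1 : ℝ) * (1 + meanSq x) := by
    intro k
    have h0 := meanSq_nonneg x
    have h1 : (0 : ℝ) ≤ N := Nat.cast_nonneg N
    rcases k with _ | i
    · simp only [Option.elim]
      nlinarith
    · have := sq_coord_le x i
      simp only [Option.elim]
      nlinarith
  rw [abs_mul]
  nlinarith [h k, h l, sq_abs (k.elim 1 fun i => (x i : ℝ)), sq_abs (l.elim 1 fun i => (x i : ℝ)),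
    sq_nonneg (|k.elim 1 fun i => (x i : ℝ)| - |l.elim 1 fun i => (x i : ℝ)|)]

/-- The mean square distance of the empirical measure from the constant `a` along a curve of test
functions which solves the backward equation `g' = -P₁ g`. -/
theorem IsBound.integral_sq_empirical_sub_le {K : ℝ} (hK : κ.IsBound K) {ν : ℝ → Measure (Config N)}
    (hν : IsForwardSolution (κ.jumpRate N) (κ.jumpMap N) ν)
    (h0 : Integrable (fun x => 1 + meanSq x) (ν 0)) {g : ℝ → C(I, ℝ)} {t : ℝ} (ht : 0 ≤ t)
    (hg : ∀ s, HasDerivAt g (-κ.opP₁ (g s)) s) {B B' ε : ℝ}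
    (hB : ∀ s ∈ Set.Icc 0 t, ‖g s‖ ≤ B)
    (hB' : ∀ s ∈ Set.Icc 0 t, ∀ u v, |κ.interaction (g s) u v| ≤ B') (hε0 : 0 ≤ ε)
    (hε : ∀ s ∈ Set.Icc 0 t, ∀ u, |(1 / (N : ℝ)) * ∑ j : Fin N, κ.interaction (g s) u (site j) -
      ∫ v : I, κ.interaction (g s) u v| ≤ ε) (a : ℝ) :
    ∫ x, (empirical x (g t) - a) ^ 2 ∂ν t ≤ ∫ x, (empirical x (g 0) - a) ^ 2 ∂ν 0 +
      (17 * K ^ 3 * B ^ 2 / N + 2 * (B + |a|) * (ε + B' / N)) *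
        (Real.exp (9 * K ^ 3 * t) * ∫ x, (1 + meanSq x) ∂ν 0) * t := by
  set δ := 17 * K ^ 3 * B ^ 2 / N + 2 * (B + |a|) * (ε + B' / N) with hδ
  have hV := hK.isLyapunov N
  set h : Option (Fin N) → Config N → ℝ := fun k x => k.elim 1 fun i => (x i : ℝ) with hh
  set c : Option (Fin N) → ℝ → ℝ := fun k s => k.elim (-a) fun i => 1 / (N : ℝ) * g s (site i)
    with hc
  set c' : Option (Fin N) → ℝ → ℝ := fun k s =>
    k.elim 0 fun i => 1 / (N : ℝ) * (-κ.opP₁ (g s)) (site i) with hc'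
  have hq : ∀ s x, ∑ k, c k s * h k x = empirical x (g s) - a := by
    intro s x
    simp only [hc, hh, Fintype.sum_option, Option.elim, empirical, Finset.mul_sum, mul_one]
    rw [neg_add_eq_sub]
    congr 1
    exact Finset.sum_congr rfl fun i _ => by ring
  have hq' : ∀ s x, ∑ k, c' k s * h k x = -empirical x (κ.opP₁ (g s)) := by
    intro s x
    simp only [hc', hh, Fintype.sum_option, Option.elim, empirical, Finset.mul_sum, mul_one,
      zero_add, ContinuousMap.neg_apply, ← Finset.sum_neg_distrib]
    exact Finset.sum_congr rfl fun i _ => by ring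
  have hcd : ∀ k s, HasDerivAt (c k) (c' k s) s := by
    intro k s
    rcases k with _ | i
    · exact hasDerivAt_const s (-a)
    · exact ((ContinuousMap.evalCLM ℝ (site i)).hasFDerivAt.comp_hasDerivAt s (hg s)).const_mul _
  have hhc : ∀ k, Continuous (h k) := by
    rintro (_ | i)
    · exact continuous_const
    · simp only [hh, Option.elim]
      fun_prop
  have hderiv : ∀ s, 0 ≤ s → HasDerivWithinAt (fun r => ∫ x, (empirical x (g r) - a) ^ 2 ∂ν r)
      (∫ x, (2 * (empirical x (g s) - a) * -empirical x (κ.opP₁ (g s)) +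
        jumpGen (κ.jumpRate N) (κ.jumpMap N) (fun y => (empirical y (g s) - a) ^ 2) x) ∂ν s)
      (Set.Ici 0) s := by
    intro s hs
    have := hν.hasDerivWithinAt_integral_sq hV h0 hhc (by positivity : (0 : ℝ) ≤ N + 1)
      (fun k l x => abs_coord_mul_coord_le x k l) hs (fun k => hcd k s)
    simpa only [hq, hq'] using this
  have hB0 : 0 ≤ B := (norm_nonneg _).trans (hB 0 ⟨le_rfl, ht⟩)
  have hB'0 : 0 ≤ B' := (abs_nonneg _).trans (hB' 0 ⟨le_rfl, ht⟩ 0 0)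
  have hK0 : 0 ≤ K := zero_le_one.trans hK.one_le
  have hδ0 : 0 ≤ δ := by positivity
  -- Here `g' = -P₁ g` cancels the main drift, and the remainder is at most `δ` times the Lyapunov
  -- function.
  have hbound : ∀ s ∈ Set.Icc 0 t,
      ∫ x, (2 * (empirical x (g s) - a) * -empirical x (κ.opP₁ (g s)) +
        jumpGen (κ.jumpRate N) (κ.jumpMap N) (fun y => (empirical y (g s) - a) ^ 2) x) ∂ν s ≤
      δ * (Real.exp (9 * K ^ 3 * t) * ∫ x, (1 + meanSq x) ∂ν 0) := by
    intro s hs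
    have hle := hν.abs_integral_le hV h0 hδ0 (h := fun x => δ * (1 + meanSq x)) (fun x => by
      rw [abs_of_nonneg (mul_nonneg hδ0 (hV.nonneg x))]) hs.1 hs.2
    refine le_trans ?_ ((le_abs_self _).trans hle)
    by_cases hi : Integrable (fun x => 2 * (empirical x (g s) - a) * -empirical x (κ.opP₁ (g s)) +
        jumpGen (κ.jumpRate N) (κ.jumpMap N) (fun y => (empirical y (g s) - a) ^ 2) x) (ν s)
    · refine integral_mono hi ((hν.integrable_lyapunov hV h0 hs.1).const_mul δ) fun x => ?_
      have := hK.jumpGen_sq_empirical_le (hB s hs) (hB' s hs) hε0 (hε s hs) a x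
      simp only []
      linarith
    -- A non-integrable integrand has integral `0` by convention, which satisfies the bound, so
    -- integrability need not be shown.
    · rw [integral_undef hi]
      exact integral_nonneg fun x => mul_nonneg hδ0 (hV.nonneg x)
  have hlin : ∀ s, HasDerivAt (fun r => ∫ x, (empirical x (g 0) - a) ^ 2 ∂ν 0 +
      δ * (Real.exp (9 * K ^ 3 * t) * ∫ x, (1 + meanSq x) ∂ν 0) * r)
      (δ * (Real.exp (9 * K ^ 3 * t) * ∫ x, (1 + meanSq x) ∂ν 0)) s := fun s => by
    have := ((hasDerivAt_id s).const_mul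
      (δ * (Real.exp (9 * K ^ 3 * t) * ∫ x, (1 + meanSq x) ∂ν 0))).const_add
      (∫ x, (empirical x (g 0) - a) ^ 2 ∂ν 0)
    rw [mul_one] at this
    exact this
  exact image_le_of_deriv_right_le_deriv_boundary
    (f := fun r => ∫ x, (empirical x (g r) - a) ^ 2 ∂ν r)
    (fun s hs => (hderiv s hs.1).continuousWithinAt.mono fun y hy => hy.1)
    (fun s hs => (hderiv s hs.1).mono (Set.Ici_subset_Ici.2 hs.1)) (by simp)
    (fun s _ => (hlin s).continuousAt.continuousWithinAt)
    (fun s _ => (hlin s).hasDerivWithinAt) (fun s hs => hbound s ⟨hs.1, hs.2.le⟩) ⟨ht, le_rfl⟩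

theorem memLp_empirical {ν : Measure (Config N)} (h : Integrable (fun x => 1 + meanSq x) ν)
    (g : C(I, ℝ)) : MemLp (fun x => empirical x g) 2 ν := by
  rw [memLp_two_iff_integrable_sq (continuous_empirical g).measurable.aestronglyMeasurable]
  refine (h.const_mul (‖g‖ ^ 2)).mono'
    ((continuous_empirical g).measurable.pow_const 2).aestronglyMeasurable
    (Eventually.of_forall fun x => ?_)
  rw [Real.norm_eq_abs, abs_of_nonneg (sq_nonneg _), ← sq_abs]
  have h1 := pow_le_pow_left₀ (abs_nonneg _) (abs_empirical_le (le_refl ‖g‖) x) 2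
  rw [mul_pow] at h1
  have h2 := mul_le_mul_of_nonneg_left (mean_sq_le x) (sq_nonneg ‖g‖)
  nlinarith [sq_nonneg ‖g‖]

end UrnCoefficients

theorem tendsto_eLpNorm_two_zero {Ω : ℕ → Type*} [∀ N, MeasurableSpace (Ω N)]
    {P : ∀ N, Measure (Ω N)} {Y : ∀ N, Ω N → ℝ} (hY : ∀ N, MemLp (Y N) 2 (P N))
    (h : Tendsto (fun N => ∫ ω, Y N ω ^ 2 ∂P N) atTop (𝓝 0)) :
    Tendsto (fun N => eLpNorm (Y N) 2 (P N)) atTop (𝓝 0) := by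
  have heq : ∀ N, eLpNorm (Y N) 2 (P N) = ENNReal.ofReal (√(∫ ω, Y N ω ^ 2 ∂P N)) := by
    intro N
    rw [(hY N).eLpNorm_eq_integral_rpow_norm two_ne_zero ENNReal.ofNat_ne_top, Real.sqrt_eq_rpow]
    simp
  simp only [heq]
  have h2 := (ENNReal.continuous_ofReal.comp Real.continuous_sqrt).tendsto 0
  simp only [Function.comp_def, Real.sqrt_zero, ENNReal.ofReal_zero] at h2
  exact h2.comp h

/-! ### Convergence and the main theorem. -/

namespace UrnCoefficients

variable {κ : UrnCoefficients}

theorem tendsto_integral_sq_empirical_sub {φ : C(I, ℝ)} {Ω : ℕ → Type*}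
    [∀ N, MeasurableSpace (Ω N)] {P : ∀ N, Measure (Ω N)} [∀ N, IsProbabilityMeasure (P N)]
    {X : ∀ N, ℝ≥0 → Ω N → Config N} (hX : ∀ N, κ.IsUrnSystem N (P N) (X N))
    (hA : ∀ N, BernoulliInitial φ (P N) (X N 0)) (t : ℝ≥0) (f : C(I, ℝ)) :
    Tendsto (fun N => ∫ ω, (empirical (X N t ω) f - κ.hydrodynamic φ t f) ^ 2 ∂P N) atTop
      (𝓝 0) := by
  obtain ⟨K, hK⟩ := κ.exists_isBound
  set a := κ.hydrodynamic φ t f with ha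
  set g : ℝ → C(I, ℝ) := fun s => expOp (((t : ℝ) - s) • κ.opP₁) f with hg
  have hgd : ∀ s, HasDerivAt g (-κ.opP₁ (g s)) s := fun s =>
    hasDerivAt_expOp_sub_smul_apply κ.opP₁ f t s
  have hgc : Continuous g := continuous_iff_continuousAt.2 fun s => (hgd s).continuousAt
  have hgt : g t = f := by
    simp only [hg, sub_self, expOp_zero_smul, ContinuousLinearMap.id_apply]
  have hg0 : a = ∫ u : I, φ u * g 0 u := by
    -- Since `g 0 = exp(t P₁) f`, the target `a` is also the limiting mean of the initial empirical
    -- measure tested against `g 0`.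
    rw [ha, hydrodynamic, ContinuousLinearMap.comp_apply, densityFunctional_apply]
    simp only [hg, sub_zero]
  -- Time joins the parameter space, which stays compact, so the Riemann sums converge uniformly in
  -- `s` and `u`.
  let G : (Set.Icc (0 : ℝ) t × I) → I → ℝ := fun y v => κ.interaction (g y.1) y.2 v
  have hG : Continuous fun p : (Set.Icc (0 : ℝ) t × I) × I => G p.1 p.2 := by
    have h1 : ∀ {k : (Set.Icc (0 : ℝ) t × I) × I → I}, Continuous k →
        Continuous fun p => g p.1.1 (k p) := fun hk =>
      ContinuousEval.continuous_eval.comp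
        ((hgc.comp (by fun_prop : Continuous fun p : (Set.Icc (0 : ℝ) t × I) × I =>
          (p.1.1 : ℝ))).prodMk hk)
    have h2 := h1 (k := fun p => p.1.2) (by fun_prop)
    have h3 := h1 (k := fun p => p.2) (by fun_prop)
    simp only [G, interaction]
    fun_prop
  obtain ⟨B, hB⟩ := (isCompact_Icc (a := (0 : ℝ)) (b := t)).exists_bound_of_continuousOn
    hgc.continuousOn
  obtain ⟨B', hB'⟩ := isCompact_univ.exists_bound_of_continuousOn hG.continuousOn
  have hmap : ∀ (N : ℕ) (r : ℝ≥0) (k : C(I, ℝ)),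
      ∫ x, (empirical x k - a) ^ 2 ∂(P N).map (X N r) =
        ∫ ω, (empirical (X N r ω) k - a) ^ 2 ∂P N := fun N r k =>
    integral_map ((hX N).measurable r).aemeasurable
      (((continuous_empirical k).sub continuous_const).pow 2).measurable.aestronglyMeasurable
  have hB0 : 0 ≤ B := (norm_nonneg _).trans (hB 0 ⟨le_rfl, t.coe_nonneg⟩)
  have hK0 : 0 ≤ K := zero_le_one.trans hK.one_le
  have hB'0 : 0 ≤ B' := (norm_nonneg _).trans (hB' ((⟨0, le_rfl, t.coe_nonneg⟩, 0), 0) trivial)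
  have key : ∀ ε > 0, ∀ᶠ N : ℕ in atTop,
      ∫ ω, (empirical (X N t ω) f - a) ^ 2 ∂P N ≤
        B ^ 2 / N + ((1 / (N : ℝ)) * ∑ i : Fin N, (φ * g 0) (site i) - a) ^ 2 +
        (17 * K ^ 3 * B ^ 2 / N + 2 * (B + |a|) * (ε + B' / N)) *
          (Real.exp (9 * K ^ 3 * t) * 2) * t := by
    intro ε hε
    filter_upwards [eventually_abs_average_site_sub_integral_le G hG hε] with N hN
    have h1 := hK.integral_sq_empirical_sub_le (hX N).isForwardSolution
      (by simpa using (hA N).integrable_meanSq ((hX N).measurable 0)) t.coe_nonneg hgd hB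
      (fun s hs u v => hB' ((⟨s, hs⟩, u), v) trivial) hε.le (fun s hs u => hN (⟨s, hs⟩, u)) a
    simp only [Real.toNNReal_zero, Real.toNNReal_coe, hmap, hgt] at h1
    refine h1.trans (add_le_add ((hA N).integral_sq_empirical_sub_le ((hX N).measurable 0)
      (hB 0 ⟨le_rfl, t.coe_nonneg⟩) a) ?_)
    have h2 := (hA N).integral_meanSq_le ((hX N).measurable 0)
    gcongr
  have hone : Tendsto (fun N : ℕ => 1 / (N : ℝ)) atTop (𝓝 0) := tendsto_one_div_atTop_nhds_zero_nat
  have hlim : ∀ ε : ℝ, Tendsto (fun N : ℕ =>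
      B ^ 2 / N + ((1 / (N : ℝ)) * ∑ i : Fin N, (φ * g 0) (site i) - a) ^ 2 +
        (17 * K ^ 3 * B ^ 2 / N + 2 * (B + |a|) * (ε + B' / N)) *
          (Real.exp (9 * K ^ 3 * t) * 2) * t) atTop
      (𝓝 (0 + (a - a) ^ 2 + (0 + 2 * (B + |a|) * (ε + 0)) * (Real.exp (9 * K ^ 3 * t) * 2) * t)) :=
      by
    intro ε
    have hinv : ∀ r : ℝ, Tendsto (fun N : ℕ => r / (N : ℝ)) atTop (𝓝 0) :=
      fun r => tendsto_const_div_atTop_nhds_zero_nat r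
    have hr := tendsto_average_site (φ * g 0)
    simp only [ContinuousMap.mul_apply, ← hg0] at hr
    refine ((hinv _).add ((hr.sub_const a).pow 2)).add ?_
    exact (((hinv _).add ((((hinv _).const_add ε)).const_mul _)).mul_const _).mul_const _
  rw [Metric.tendsto_nhds]
  intro η hη
  -- `R` is the coefficient of `ε` in the limit of the bound as `N → ∞`; with `ε = η / (2 (R + 1))`
  -- that limit is below `η`, also when `R = 0`.
  set R := 2 * (B + |a|) * (Real.exp (9 * K ^ 3 * t) * 2) * t with hR
  have hR0 : 0 ≤ R := by positivity
  have hε : 0 < η / (2 * (R + 1)) := by positivity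
  have hlt : 0 + (a - a) ^ 2 + (0 + 2 * (B + |a|) * (η / (2 * (R + 1)) + 0)) *
      (Real.exp (9 * K ^ 3 * t) * 2) * t < η := by
    have h1 : 0 + (a - a) ^ 2 + (0 + 2 * (B + |a|) * (η / (2 * (R + 1)) + 0)) *
      (Real.exp (9 * K ^ 3 * t) * 2) * t = R * η / (2 * (R + 1)) := by
      rw [hR]
      ring
    rw [h1, div_lt_iff₀ (by positivity)]
    nlinarith
  filter_upwards [key _ hε, (hlim _).eventually (gt_mem_nhds hlt)] with N h1 h2
  rw [Real.dist_eq, sub_zero, abs_of_nonneg (integral_nonneg fun ω => sq_nonneg _)]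
  exact h1.trans_lt h2

end UrnCoefficients

theorem theorem2p2 (κ : UrnCoefficients) (φ : C(I, ℝ))
    {Ω : ℕ → Type*} [∀ N, MeasurableSpace (Ω N)] (P : ∀ N, Measure (Ω N))
    [∀ N, IsProbabilityMeasure (P N)] (X : ∀ N, ℝ≥0 → Ω N → Config N)
    (hX : ∀ N, κ.IsUrnSystem N (P N) (X N))
    (hA : ∀ N, BernoulliInitial φ (P N) (X N 0)) :
    ∃ (μ : ℝ → (C(I, ℝ) →L[ℝ] ℝ)) (ρ : ℝ → C(I, ℝ)),
      (κ.IsHydrodynamicSolution φ μ ∧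
        ∀ μ', κ.IsHydrodynamicSolution φ μ' → Set.EqOn μ' μ (Set.Ici 0)) ∧
      (κ.IsDensitySolution φ ρ ∧
        ∀ ρ', κ.IsDensitySolution φ ρ' → Set.EqOn ρ' ρ (Set.Ici 0)) ∧
      ∀ (t : ℝ≥0) (f : C(I, ℝ)),
        μ t f = ∫ u : I, ρ t u * f u ∧
        (∀ N, MemLp (fun ω => empirical (X N t ω) f) 2 (P N)) ∧
        Tendsto (fun N => eLpNorm (fun ω => empirical (X N t ω) f - μ t f) 2 (P N))
          atTop (𝓝 0) := by
  have hμ := κ.isHydrodynamicSolution_hydrodynamic φ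
  have hρ := κ.isDensitySolution_density φ
  refine ⟨κ.hydrodynamic φ, κ.density φ, ⟨hμ, fun μ' h => h.eqOn hμ⟩,
    ⟨hρ, fun ρ' h => h.eqOn hρ⟩, fun t f => ?_⟩
  have hL : ∀ N, MemLp (fun ω => empirical (X N t ω) f) 2 (P N) := by
    intro N
    obtain ⟨K, hK⟩ := κ.exists_isBound
    -- Square integrability is read off from the law of `X N t`, where the Lyapunov function is
    -- integrable, and then pulled back to `Ω N`.
    have h := (hX N).isForwardSolution.integrable_lyapunov (hK.isLyapunov N)
      (by simpa using (hA N).integrable_meanSq ((hX N).measurable 0)) t.coe_nonneg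
    rw [Real.toNNReal_coe] at h
    exact (UrnCoefficients.memLp_empirical h f).comp_measurePreserving
      (((hX N).measurable t).measurePreserving _)
  refine ⟨?_, hL, ?_⟩
  · rw [← densityFunctional_apply, ← hρ.isHydrodynamicSolution.eqOn hμ (Set.mem_Ici.2 t.coe_nonneg)]
  · exact tendsto_eLpNorm_two_zero (fun N => (hL N).sub (memLp_const _))
      (UrnCoefficients.tendsto_integral_sq_empirical_sub hX hA t f)

end
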